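/- Let $\mathcal H=\mathbb C^d$ and let $\mathfrak A_\infty$ be the quasilocal $C^*$-algebra of the spin lattice over $\mathbb Z$ with the algebra $M_d(\mathbb C)$ at every site, i.e. the operator norm completion of the union of the local algebras $\mathfrak A_\Lambda=\bigotimes_{x\in\Lambda}M_d(\mathbb C)$ over all finite $\Lambda\subset\mathbb Z$; let $\gamma$ be the automorphism of $\mathfrak A_\infty$ induced by the right shift of $\mathbb Z$. A state $\varphi$ (a normalised positive functional) on $\mathfrak A_\infty$ is called stationary if $\varphi\circ\gamma=\varphi$. A stationary state is called ergodic if it is an extremal point of the set of all stationary states, weakly mixing if $$\lim_{n\to\infty}\frac1n\sum_{i=1}^n\bigl|\varphi(a\,\gamma^i(b))-\varphi(a)\varphi(b)\bigr|=0\qquad\text{for all }a,b\in\mathfrak A_\infty,$$ and strongly mixing if $$\lim_{i\to\infty}\varphi(a\,\gamma^i(b))=\varphi(a)\varphi(b)\qquad\text{for all }a,b\in\mathfrak A_\infty.$$ A family $\{\rho_m\}_{m\ge 1}$ with $\rho_m\in\mathfrak A_{\{1,\dots,m\}}$ is called a stationary (stationary and ergodic, weakly mixing, strongly mixing) quantum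 source if there is a stationary (ergodic, weakly mixing, strongly mixing) state $\varphi$ on $\mathfrak A_\infty$ such that $\varphi(a)=\mathrm{tr}(\rho_m a)$ for all $m$ and all $a\in\mathfrak A_{\{1,\dots,m\}}$; a stationary state is determined by these density operators. Let $\{|\psi_x\rangle\}_{x\in X}$ be a finite linearly independent family of unit vectors in $\mathcal H$, let $\mu$ be a probability measure on the space $X^{\mathbb Z}$ of bi-infinite sequences with its product $\sigma$-algebra, let $T$ be the shift of $X^{\mathbb Z}$, $(T\omega)_k=\omega_{k+1}$, and let $p(x_1,\dots,x_m)=\mu\{\omega:\omega_1=x_1,\dots,\omega_m=x_m\}$. Define the classically correlated quantum source $$\rho_m^{cls}=\sum_{x_1,\dots,x_m\in X}p(x_1,\dots,x_m)\,|\psi_{x_1}\rangle\langle\psi_{x_1}|\otimes\cdots\otimes|\psi_{x_m}\rangle\langle\psi_{x_m}|.$$ Then: 1. if $p$ is stationary, i.e. $T$ preserves $\mu$, then $\{\rho_m^{cls}\}$ is a stationary quantum source; 2. if $p$ is stationary and ergodic, i.e. $T$ preserves $\mu$ and every measurable set $A$ with $T^{-1}A=A$ has measure $0$ or $1$, then $\{\rho_m^{cls}\}$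 is a stationary and ergodic quantum source; 3. if $p$ is stationary and weakly mixing, i.e. $T$ preserves $\mu$ and $\frac1n\sum_{i=1}^n|\mu(A\cap T^{-i}B)-\mu(A)\mu(B)|\to0$ for all measurable $A,B$, then $\{\rho_m^{cls}\}$ is a stationary and weakly mixing quantum source; 4. if $p$ is stationary and strongly mixing, i.e. $T$ preserves $\mu$ and $\mu(A\cap T^{-i}B)\to\mu(A)\mu(B)$ for all measurable $A,B$, then $\{\rho_m^{cls}\}$ is a stationary and strongly mixing quantum source. -/

import Mathlib

noncomputable section

namespace QSource

open scoped ENNReal ComplexOrder InnerProductSpace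
open MeasureTheory Filter Topology

/-! ## The lattice system and its local observables -/

/-- Configurations of the lattice `ℤ` with `d` basis states at every site. -/
abbrev Config (d : ℕ) : Type := ℤ → Fin d

/-- The Hilbert space with orthonormal basis `e_ω` indexed by all configurations `ω`.  Every local
algebra of the lattice acts on it, compatibly with the inclusions of regions; its only role is
to carry the operator norm in which the quasilocal algebra is completed. -/
abbrev ConfigSpace (d : ℕ) : Type := lp (fun _ : Config d => ℂ) 2

/-- The algebra `⨂_{x ∈ Λ} M_d(ℂ)` of observables of the sites in `Λ`, realised as the matrices
indexed by the configurations on `Λ`; the elementary tensors are given by `tensorMatrix`. -/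
abbrev LocalMatrix (d : ℕ) (Λ : Finset ℤ) : Type :=
  Matrix ((x : Λ) → Fin d) ((x : Λ) → Fin d) ℂ

/-- The elementary tensor `⨂_{x ∈ Λ} A x`. -/
def tensorMatrix {d : ℕ} {Λ : Finset ℤ} (A : Λ → Matrix (Fin d) (Fin d) ℂ) : LocalMatrix d Λ :=
  Matrix.of fun ζ η => ∏ x, A x (ζ x) (η x)

lemma memlp_partialComp {d : ℕ} (s : Set (Config d)) (g : Config d → Config d)
    (hg : Set.InjOn g s) (f : ConfigSpace d) (t : Finset (Config d)) :
    ∑ ω ∈ t, ‖s.indicator (fun ω => f (g ω)) ω‖ ^ (2 : ℝ≥0∞).toReal ≤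
      ‖f‖ ^ (2 : ℝ≥0∞).toReal := by
  classical
  calc ∑ ω ∈ t, ‖s.indicator (fun ω => f (g ω)) ω‖ ^ (2 : ℝ≥0∞).toReal
      = ∑ ω ∈ t with ω ∈ s, ‖f (g ω)‖ ^ (2 : ℝ≥0∞).toReal := by
        rw [Finset.sum_filter]
        refine Finset.sum_congr rfl fun ω _ => ?_
        by_cases h : ω ∈ s <;> simp [h]
    _ = ∑ τ ∈ (t.filter (· ∈ s)).image g, ‖f τ‖ ^ (2 : ℝ≥0∞).toReal := by
        rw [Finset.sum_image]
        intro a ha b hb hab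
        exact hg (by simpa using (Finset.mem_filter.1 ha).2)
          (by simpa using (Finset.mem_filter.1 hb).2) hab
    _ ≤ _ := lp.sum_rpow_le_norm_rpow (by norm_num) f _

/-- For `g` injective on `s`, the bounded operator `f ↦ 1_s · (f ∘ g)`. -/
def partialComp {d : ℕ} (s : Set (Config d)) (g : Config d → Config d) (hg : Set.InjOn g s) :
    ConfigSpace d →L[ℂ] ConfigSpace d :=
  LinearMap.mkContinuous
    { toFun := fun f => ⟨s.indicator (fun ω => f (g ω)),
        memℓp_gen' (C := ‖f‖ ^ (2 : ℝ≥0∞).toReal) (memlp_partialComp s g hg f)⟩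
      map_add' := fun f₁ f₂ => by
        ext ω
        change s.indicator (fun ω => (f₁ + f₂) (g ω)) ω =
          s.indicator (fun ω => f₁ (g ω)) ω + s.indicator (fun ω => f₂ (g ω)) ω
        by_cases h : ω ∈ s <;> simp [h]
      map_smul' := fun c f => by
        ext ω
        by_cases h : ω ∈ s <;> simp [h] }
    1 (fun f => by
      rw [one_mul]
      exact lp.norm_le_of_forall_sum_le (by norm_num) (norm_nonneg _)
        (memlp_partialComp s g hg f))

lemma partialComp_apply {d : ℕ} (s : Set (Config d)) (g : Config d → Config d)
    (hg : Set.InjOn g s) (f : ConfigSpace d) (ω : Config d) :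
    partialComp s g hg f ω = s.indicator (fun ω => f (g ω)) ω := rfl

lemma updateFinset_injOn {d : ℕ} (Λ : Finset ℤ) (ζ η : Λ → Fin d) :
    Set.InjOn (fun ω : Config d => Function.updateFinset ω Λ η) {ω | Λ.restrict ω = ζ} := by
  intro ω hω τ hτ h
  funext x
  by_cases hx : x ∈ Λ
  · have h1 := congrFun (hω.trans hτ.symm) ⟨x, hx⟩
    simpa using h1
  · have h1 := congrFun h x
    simpa [Function.updateFinset, hx] using h1

/-- The operator `|ζ⟩⟨η| ⊗ 1`, where `|ζ⟩⟨η|` acts on the sites in `Λ`: it sends the basis vector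
of a configuration equal to `η` on `Λ` to that of the configuration with `η` replaced by `ζ`, and
all other basis vectors to `0`. -/
def matrixUnit {d : ℕ} (Λ : Finset ℤ) (ζ η : Λ → Fin d) : ConfigSpace d →L[ℂ] ConfigSpace d :=
  partialComp {ω | Λ.restrict ω = ζ} (fun ω => Function.updateFinset ω Λ η)
    (updateFinset_injOn Λ ζ η)

/-- The operator `a ⊗ 1`, where `a` acts on the sites in `Λ` and `1` on all the others. -/
def localOp {d : ℕ} (Λ : Finset ℤ) (a : LocalMatrix d Λ) : ConfigSpace d →L[ℂ] ConfigSpace d :=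
  ∑ ζ, ∑ η, a ζ η • matrixUnit Λ ζ η

lemma localOp_apply {d : ℕ} (Λ : Finset ℤ) (a : LocalMatrix d Λ) (f : ConfigSpace d)
    (ω : Config d) :
    localOp Λ a f ω = ∑ η, a (Λ.restrict ω) η * f (Function.updateFinset ω Λ η) := by
  classical
  have h : localOp Λ a f ω = ∑ ζ, ∑ η, a ζ η * matrixUnit Λ ζ η f ω := by
    have hs : ∀ (s : Finset (Λ → Fin d)) (F : (Λ → Fin d) → ConfigSpace d),
        (∑ i ∈ s, F i : ConfigSpace d) ω = ∑ i ∈ s, F i ω := fun s F => by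
      rw [lp.coeFn_sum, Finset.sum_apply]
    simp only [localOp, sum_apply, hs]
    rfl
  rw [h, Finset.sum_eq_single (Λ.restrict ω)]
  · simp [matrixUnit, partialComp_apply]
  · intro ζ _ hζ
    simp [matrixUnit, partialComp_apply, Ne.symm hζ]
  · simp

lemma updateFinset_update {d : ℕ} (Λ : Finset ℤ) (ω : Config d) (ζ η : Λ → Fin d) :
    Function.updateFinset (Function.updateFinset ω Λ ζ) Λ η = Function.updateFinset ω Λ η := by
  funext x
  by_cases hx : x ∈ Λ <;> simp [Function.updateFinset, hx]

lemma restrict_update {d : ℕ} (Λ : Finset ℤ) (ω : Config d) (ζ : Λ → Fin d) :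
    Λ.restrict (Function.updateFinset ω Λ ζ) = ζ := by
  funext x
  simp [Function.updateFinset]

lemma update_restrict {d : ℕ} (Λ : Finset ℤ) (ω : Config d) :
    Function.updateFinset ω Λ (Λ.restrict ω) = ω := by
  funext x
  by_cases hx : x ∈ Λ <;> simp [Function.updateFinset, hx]

lemma localOp_one {d : ℕ} (Λ : Finset ℤ) : localOp Λ (1 : LocalMatrix d Λ) = 1 := by
  ext f ω
  simp [localOp_apply, Matrix.one_apply]

lemma localOp_mul {d : ℕ} (Λ : Finset ℤ) (a b : LocalMatrix d Λ) :
    localOp Λ (a * b) = localOp Λ a * localOp Λ b := by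
  ext f ω
  simp only [localOp_apply, mul_apply_eq_comp, Matrix.mul_apply, restrict_update,
    updateFinset_update, Finset.sum_mul, Finset.mul_sum]
  rw [Finset.sum_comm]
  simp [mul_assoc]

lemma localOp_add {d : ℕ} (Λ : Finset ℤ) (a b : LocalMatrix d Λ) :
    localOp Λ (a + b) = localOp Λ a + localOp Λ b := by
  simp [localOp, add_smul, Finset.sum_add_distrib]

lemma localOp_smul {d : ℕ} (Λ : Finset ℤ) (c : ℂ) (a : LocalMatrix d Λ) :
    localOp Λ (c • a) = c • localOp Λ a := by
  simp [localOp, Finset.smul_sum, mul_smul]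

lemma localOp_star {d : ℕ} (Λ : Finset ℤ) (a : LocalMatrix d Λ) :
    localOp Λ (star a) = star (localOp Λ a) := by
  classical
  ext f ω
  have h1 : star (localOp Λ a) f ω = inner ℂ (localOp Λ a (lp.single 2 ω 1)) f := by
    have := lp.inner_single_left (𝕜 := ℂ) ω (1 : ℂ) (star (localOp Λ a) f)
    rw [ContinuousLinearMap.star_eq_adjoint, ContinuousLinearMap.adjoint_inner_right] at this
    rw [ContinuousLinearMap.star_eq_adjoint, this]
    simp
  have h2 : localOp Λ a (lp.single 2 ω 1) =
      ∑ ζ, lp.single 2 (Function.updateFinset ω Λ ζ) (a ζ (Λ.restrict ω)) := by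
    ext τ
    rw [localOp_apply, lp.coeFn_sum, Finset.sum_apply,
      Finset.sum_eq_single (Λ.restrict ω), Finset.sum_eq_single (Λ.restrict τ)]
    · simp only [lp.single_apply, Pi.single_apply]
      have : Function.updateFinset τ Λ (Λ.restrict ω) = ω ↔
          τ = Function.updateFinset ω Λ (Λ.restrict τ) := by
        constructor <;> intro h
        · rw [← h, updateFinset_update, update_restrict]
        · rw [h, updateFinset_update, update_restrict]
      by_cases h : τ = Function.updateFinset ω Λ (Λ.restrict τ)
      · rw [this.2 h, ← h]
        simp
      · rw [if_neg (fun h' => h (this.1 h')), if_neg h, mul_zero]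
    · intro ζ _ hζ
      rw [lp.single_apply, Pi.single_eq_of_ne]
      intro h
      exact hζ (by rw [h, restrict_update])
    · simp
    · intro ζ _ hζ
      rw [lp.single_apply, Pi.single_eq_of_ne, mul_zero]
      intro h
      exact hζ (by rw [← h, restrict_update])
    · simp
  rw [h1, h2, sum_inner, localOp_apply]
  refine Finset.sum_congr rfl fun ζ _ => ?_
  rw [lp.inner_single_left]
  simp [Matrix.star_apply, mul_comm]

lemma localOp_injective {d : ℕ} [NeZero d] (Λ : Finset ℤ) :
    Function.Injective (localOp (d := d) Λ) := by
  classical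
  intro a b hab
  ext ζ η
  let ω₀ : Config d := fun _ => 0
  have h := congrArg (fun T : ConfigSpace d →L[ℂ] ConfigSpace d =>
    T (lp.single 2 (Function.updateFinset ω₀ Λ η) 1) (Function.updateFinset ω₀ Λ ζ)) hab
  have key : ∀ c : LocalMatrix d Λ, localOp Λ c (lp.single 2 (Function.updateFinset ω₀ Λ η) 1)
      (Function.updateFinset ω₀ Λ ζ) = c ζ η := by
    intro c
    rw [localOp_apply, Finset.sum_eq_single η]
    · simp [restrict_update, updateFinset_update]
    · intro τ _ hτ
      rw [lp.single_apply, Pi.single_eq_of_ne, mul_zero]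
      intro h
      exact hτ (by rw [← restrict_update Λ ω₀ η, ← h, restrict_update])
    · simp
  simpa only [key] using h

/-- Observables of `Λ` are observables of every larger region. -/
lemma localOp_mono {d : ℕ} {Λ Λ' : Finset ℤ} (h : Λ ⊆ Λ') (a : LocalMatrix d Λ) :
    ∃ a' : LocalMatrix d Λ', localOp Λ' a' = localOp Λ a := by
  classical
  let r : (Λ' → Fin d) → (Λ → Fin d) := fun ζ x => ζ ⟨x, h x.2⟩
  let u : (Λ' → Fin d) → (Λ → Fin d) → (Λ' → Fin d) := fun ζ η x =>
    if hx : (x : ℤ) ∈ Λ then η ⟨x, hx⟩ else ζ x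
  refine ⟨Matrix.of fun ζ ξ => ∑ η, if ξ = u ζ η then a (r ζ) η else 0, ?_⟩
  ext f ω
  simp only [localOp_apply, Matrix.of_apply, Finset.sum_mul]
  rw [Finset.sum_comm]
  refine Finset.sum_congr rfl fun η _ => ?_
  rw [Finset.sum_eq_single (u (Λ'.restrict ω) η)]
  · have h1 : Function.updateFinset ω Λ' (u (Λ'.restrict ω) η) = Function.updateFinset ω Λ η := by
      funext x
      by_cases hx : x ∈ Λ
      · simp [Function.updateFinset, hx, h hx, u]
      · by_cases hx' : x ∈ Λ' <;> simp [Function.updateFinset, hx, hx', u]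
    rw [h1, if_pos rfl]
    rfl
  · intro ξ _ hξ
    simp [hξ]
  · simp

/-! ## The quasilocal algebra and the shift -/

/-- The union of the local algebras over all finite regions. -/
def localAlgebra (d : ℕ) : StarSubalgebra ℂ (ConfigSpace d →L[ℂ] ConfigSpace d) where
  carrier := {T | ∃ (Λ : Finset ℤ) (a : LocalMatrix d Λ), localOp Λ a = T}
  mul_mem' := by
    rintro _ _ ⟨Λ₁, a, rfl⟩ ⟨Λ₂, b, rfl⟩
    obtain ⟨a', ha⟩ := localOp_mono (Finset.subset_union_left (s₁ := Λ₁) (s₂ := Λ₂)) a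
    obtain ⟨b', hb⟩ := localOp_mono (Finset.subset_union_right (s₁ := Λ₁) (s₂ := Λ₂)) b
    exact ⟨Λ₁ ∪ Λ₂, a' * b', by rw [localOp_mul, ha, hb]⟩
  add_mem' := by
    rintro _ _ ⟨Λ₁, a, rfl⟩ ⟨Λ₂, b, rfl⟩
    obtain ⟨a', ha⟩ := localOp_mono (Finset.subset_union_left (s₁ := Λ₁) (s₂ := Λ₂)) a
    obtain ⟨b', hb⟩ := localOp_mono (Finset.subset_union_right (s₁ := Λ₁) (s₂ := Λ₂)) b
    exact ⟨Λ₁ ∪ Λ₂, a' + b', by rw [localOp_add, ha, hb]⟩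
  algebraMap_mem' := fun c => ⟨∅, c • 1, by
    rw [localOp_smul, localOp_one, Algebra.algebraMap_eq_smul_one]⟩
  star_mem' := by
    rintro _ ⟨Λ, a, rfl⟩
    exact ⟨Λ, star a, localOp_star Λ a⟩

/-- The quasilocal algebra: the completion of the union of the local algebras in the operator
norm, that is, its closure in the complete algebra of bounded operators.  For `d ≥ 1` each
`localOp Λ` is an injective star homomorphism (`localOp_mul`, `localOp_star`,
`localOp_injective`), hence isometric for the C*-norm of `⨂_{x ∈ Λ} M_d(ℂ)`. -/
abbrev quasilocal (d : ℕ) : StarSubalgebra ℂ (ConfigSpace d →L[ℂ] ConfigSpace d) :=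
  (localAlgebra d).topologicalClosure

/-- A local observable as an element of the quasilocal algebra. -/
def localObs {d : ℕ} (Λ : Finset ℤ) (a : LocalMatrix d Λ) : quasilocal d :=
  ⟨localOp Λ a, (localAlgebra d).le_topologicalClosure ⟨Λ, a, rfl⟩⟩

lemma translate_injOn (d : ℕ) (k : ℤ) :
    Set.InjOn (fun (ω : Config d) x => ω (x + k)) Set.univ := by
  intro ω _ τ _ h
  funext x
  simpa using congrFun h (x - k)

/-- The operator `f ↦ f ∘ T`, where `T` translates configurations by `k`. -/
def translate (d : ℕ) (k : ℤ) : ConfigSpace d →L[ℂ] ConfigSpace d :=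
  partialComp Set.univ (fun ω x => ω (x + k)) (translate_injOn d k)

lemma translate_apply (d : ℕ) (k : ℤ) (f : ConfigSpace d) (ω : Config d) :
    translate d k f ω = f fun x => ω (x + k) := by
  rw [translate, partialComp_apply, Set.indicator_of_mem (Set.mem_univ ω)]

lemma norm_translate_le (d : ℕ) (k : ℤ) (f : ConfigSpace d) : ‖translate d k f‖ ≤ ‖f‖ :=
  lp.norm_le_of_forall_sum_le (by norm_num) (norm_nonneg _) 
    (memlp_partialComp _ _ (translate_injOn d k) f)

lemma translate_neg (d : ℕ) (k : ℤ) (f : ConfigSpace d) :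
    translate d (-k) (translate d k f) = f := by
  ext ω
  simp [translate_apply]

/-- The unitary on the configuration space which moves every configuration one site to the right:
the basis vector of `ω` goes to the basis vector of `x ↦ ω (x - 1)`. -/
def shiftUnitary (d : ℕ) : ConfigSpace d ≃ₗᵢ[ℂ] ConfigSpace d where
  toLinearEquiv := LinearEquiv.ofLinearMap (translate d 1).toLinearMap (translate d (-1)).toLinearMap
    (by
      ext1 f
      simpa using translate_neg d (-1) f)
    (by
      ext1 f
      simpa using translate_neg d 1 f)
  norm_map' f := by
    refine le_antisymm (norm_translate_le d 1 f) ?_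
    have h := norm_translate_le d (-1) (translate d 1 f)
    rw [translate_neg] at h
    exact h

lemma shiftUnitary_apply (d : ℕ) (f : ConfigSpace d) (ω : Config d) :
    shiftUnitary d f ω = f fun x => ω (x + 1) := translate_apply d 1 f ω

lemma shiftUnitary_symm_apply (d : ℕ) (f : ConfigSpace d) (ω : Config d) :
    (shiftUnitary d).symm f ω = f fun x => ω (x - 1) := by
  exact translate_apply d (-1) f ω

/-- Conjugation by the shift maps the observable `a` of the region `Λ` to its copy on `Λ + 1`. -/
lemma conj_shift_localOp {d : ℕ} (Λ : Finset ℤ) (a : LocalMatrix d Λ) :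
    (shiftUnitary d).conjStarAlgEquiv (localOp Λ a) =
      localOp (Λ.map (addRightEmbedding 1))
        (Matrix.of fun ζ η =>
          a (fun x => ζ ⟨x + 1, by simp⟩) (fun x => η ⟨x + 1, by simp⟩)) := by
  classical
  ext f ω
  rw [LinearIsometryEquiv.conjStarAlgEquiv_apply_apply, shiftUnitary_apply, localOp_apply,
    localOp_apply]
  let e : (Λ.map (addRightEmbedding (1 : ℤ)) → Fin d) ≃ (Λ → Fin d) :=
    { toFun := fun ζ x => ζ ⟨x + 1, by simp⟩
      invFun := fun η x => η ⟨x - 1, by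
        obtain ⟨y, hy, hyx⟩ := Finset.mem_map.1 x.2
        have : (x : ℤ) = y + 1 := by simpa using hyx.symm
        simpa [this] using hy⟩
      left_inv := fun ζ => by funext x; simp
      right_inv := fun η => by funext x; simp }
  refine (Fintype.sum_equiv e _ _ fun ζ => ?_).symm
  rw [shiftUnitary_symm_apply]
  refine congrArg₂ (· * ·) rfl (congrArg _ ?_)
  funext x
  by_cases hx : x ∈ Λ.map (addRightEmbedding (1 : ℤ))
  · obtain ⟨y, hy, rfl⟩ := Finset.mem_map.1 hx
    simp [Function.updateFinset, hy, e]
  · have hx' : x - 1 ∉ Λ := fun h => hx (Finset.mem_map.2 ⟨x - 1, h, by simp⟩)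
    simp only [Function.updateFinset, hx, hx', dite_false]
    simp

lemma conj_shift_mem {d : ℕ} (a : quasilocal d) :
    (shiftUnitary d).conjStarAlgEquiv (a : ConfigSpace d →L[ℂ] ConfigSpace d) ∈ quasilocal d := by
  have hc : Continuous fun T : ConfigSpace d →L[ℂ] ConfigSpace d =>
      (shiftUnitary d).conjStarAlgEquiv T := by
    simp only [LinearIsometryEquiv.conjStarAlgEquiv_apply]
    fun_prop
  have ha : (a : ConfigSpace d →L[ℂ] ConfigSpace d) ∈
      closure (localAlgebra d : Set (ConfigSpace d →L[ℂ] ConfigSpace d)) := a.2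
  refine map_mem_closure hc ha ?_
  rintro _ ⟨Λ, b, rfl⟩
  exact ⟨_, _, (conj_shift_localOp Λ b).symm⟩

/-- The automorphism of the quasilocal algebra induced by the right shift of the lattice. -/
def shift (d : ℕ) : quasilocal d →⋆ₐ[ℂ] quasilocal d :=
  StarAlgHom.codRestrict
    (((shiftUnitary d).conjStarAlgEquiv : _ →⋆ₐ[ℂ] _).comp (quasilocal d).subtype)
    (quasilocal d) conj_shift_mem

/-- The shift moves the observable `a` of the region `Λ` to its copy on `Λ + 1`. -/
lemma shift_localObs {d : ℕ} (Λ : Finset ℤ) (a : LocalMatrix d Λ) :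
    shift d (localObs Λ a) = localObs (Λ.map (addRightEmbedding 1))
      (Matrix.of fun ζ η =>
        a (fun x => ζ ⟨x + 1, by simp⟩) (fun x => η ⟨x + 1, by simp⟩)) :=
  Subtype.ext (conj_shift_localOp Λ a)

/-! ## States of the quasilocal algebra -/

/-- A normalised positive functional on the quasilocal algebra. -/
structure IsState {d : ℕ} (φ : quasilocal d →L[ℂ] ℂ) : Prop where
  nonneg : ∀ a, 0 ≤ φ (star a * a)
  map_one : φ 1 = 1

/-- A state invariant under the shift. -/
structure IsStationaryState {d : ℕ} (φ : quasilocal d →L[ℂ] ℂ) : Prop extends IsState φ where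
  map_shift : ∀ a, φ (shift d a) = φ a

/-- An ergodic state: an extremal point of the set of all stationary states. -/
def IsErgodicState {d : ℕ} (φ : quasilocal d →L[ℂ] ℂ) : Prop :=
  φ ∈ Set.extremePoints ℝ {χ : quasilocal d →L[ℂ] ℂ | IsStationaryState χ}

/-- A weakly mixing stationary state. -/
structure IsWeaklyMixingState {d : ℕ} (φ : quasilocal d →L[ℂ] ℂ) : Prop
    extends IsStationaryState φ where
  tendsto : ∀ a b, Tendsto
    (fun n : ℕ => (n : ℝ)⁻¹ * ∑ i ∈ Finset.Icc 1 n, ‖φ (a * (shift d)^[i] b) - φ a * φ b‖)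
    atTop (𝓝 0)

/-- A strongly mixing stationary state. -/
structure IsStronglyMixingState {d : ℕ} (φ : quasilocal d →L[ℂ] ℂ) : Prop
    extends IsStationaryState φ where
  tendsto : ∀ a b, Tendsto (fun i : ℕ => φ (a * (shift d)^[i] b)) atTop (𝓝 (φ a * φ b))

/-! ## Quantum sources as families of density matrices -/

/-- The box `{1, …, m}` of the lattice. -/
abbrev box (m : ℕ) : Finset ℤ := Finset.Icc 1 (m : ℤ)

/-- The state `φ` has the densities `ρ m` on the boxes `{1, …, m}`. -/
def HasDensities {d : ℕ} (φ : quasilocal d →L[ℂ] ℂ) (ρ : (m : ℕ) → LocalMatrix d (box m)) :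
    Prop :=
  ∀ (m : ℕ) (a : LocalMatrix d (box m)), φ (localObs (box m) a) = (ρ m * a).trace

/-- The family `ρ` is a stationary source: it is the family of densities of a stationary state.
(A stationary state is determined by its densities on the boxes `{1, …, m}`.) -/
def IsStationarySource {d : ℕ} (ρ : (m : ℕ) → LocalMatrix d (box m)) : Prop :=
  ∃ φ : quasilocal d →L[ℂ] ℂ, HasDensities φ ρ ∧ IsStationaryState φ

/-- The family `ρ` is a stationary and ergodic source. -/
def IsErgodicSource {d : ℕ} (ρ : (m : ℕ) → LocalMatrix d (box m)) : Prop :=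
  ∃ φ : quasilocal d →L[ℂ] ℂ, HasDensities φ ρ ∧ IsErgodicState φ

/-- The family `ρ` is a stationary and weakly mixing source. -/
def IsWeaklyMixingSource {d : ℕ} (ρ : (m : ℕ) → LocalMatrix d (box m)) : Prop :=
  ∃ φ : quasilocal d →L[ℂ] ℂ, HasDensities φ ρ ∧ IsWeaklyMixingState φ

/-- The family `ρ` is a stationary and strongly mixing source. -/
def IsStronglyMixingSource {d : ℕ} (ρ : (m : ℕ) → LocalMatrix d (box m)) : Prop :=
  ∃ φ : quasilocal d →L[ℂ] ℂ, HasDensities φ ρ ∧ IsStronglyMixingState φ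

/-! ## Classical sources -/

/-- The shift of bi-infinite sequences. -/
def seqShift (ι : Type*) (ω : ℤ → ι) : ℤ → ι := fun x => ω (x + 1)

/-- The probability `p(x₁, …, x_m)` of a word under the law `μ` of a bi-infinite sequence. -/
def wordProb {ι : Type*} [MeasurableSpace ι] (μ : Measure (ℤ → ι)) (m : ℕ) (x : box m → ι) : ℝ :=
  μ.real {ω | ∀ i : box m, ω i = x i}

/-- A measure-preserving map is weakly mixing. -/
structure IsWeaklyMixing {Ω : Type*} [MeasurableSpace Ω] (T : Ω → Ω) (μ : Measure Ω) : Prop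
    extends MeasurePreserving T μ μ where
  tendsto : ∀ A B : Set Ω, MeasurableSet A → MeasurableSet B → Tendsto
    (fun n : ℕ => (n : ℝ)⁻¹ *
      ∑ i ∈ Finset.Icc 1 n, |μ.real (A ∩ T^[i] ⁻¹' B) - μ.real A * μ.real B|)
    atTop (𝓝 0)

/-- A measure-preserving map is strongly mixing. -/
structure IsStronglyMixing {Ω : Type*} [MeasurableSpace Ω] (T : Ω → Ω) (μ : Measure Ω) : Prop
    extends MeasurePreserving T μ μ where
  tendsto : ∀ A B : Set Ω, MeasurableSet A → MeasurableSet B →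
    Tendsto (fun i : ℕ => μ.real (A ∩ T^[i] ⁻¹' B)) atTop (𝓝 (μ.real A * μ.real B))

/-! ## Classically correlated quantum sources -/

/-- The rank-one operator `|v⟩⟨v|`. -/
def ketbra {d : ℕ} (v : EuclideanSpace ℂ (Fin d)) : Matrix (Fin d) (Fin d) ℂ :=
  Matrix.vecMulVec (fun i => v i) (fun i => star (v i))

/-- The classically correlated source with alphabet `ψ` and word probabilities `p`:
`ρ_m = ∑ p(x₁, …, x_m) |ψ_{x₁}⟩⟨ψ_{x₁}| ⊗ ⋯ ⊗ |ψ_{x_m}⟩⟨ψ_{x_m}|`. -/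
def clsSource {d : ℕ} {ι : Type*} [Fintype ι] (ψ : ι → EuclideanSpace ℂ (Fin d))
    (p : (m : ℕ) → (box m → ι) → ℝ) (m : ℕ) : LocalMatrix d (box m) :=
  ∑ x : box m → ι, (p m x : ℂ) • tensorMatrix fun i => ketbra (ψ (x i))

end QSource

end

/-!
The density operators are those of the mixture `φ = ∫ φ_ω dμ(ω)` of the product states
`φ_ω = ⨂_x |ψ_{ω x}⟩⟨ψ_{ω x}|`.  By the law of total covariance, a correlation of `φ` is the mean of
the correlations in the `φ_ω` plus the classical covariance of the expectations `ω ↦ φ_ω(a)`.  The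
first part vanishes for observables of disjoint regions.  For local observables the second is the
covariance of functions of finitely many letters, so mixing passes from `μ` to local observables,
and to all others by density.

For ergodicity, the variance in `φ` of the averages `A_n = n⁻¹ ∑_{i < n} γ^i(a)` tends to zero: its
first part is `O(1/n)` uniformly in `ω`, because only near-diagonal correlations survive, and its
second part tends to zero by the mean ergodic theorem.  If `φ = t χ₁ + (1 - t) χ₂` with stationary
`χ₁`, the variance bounds `t |χ₁(A_n) - φ(A_n)|² = t |χ₁(a) - φ(a)|²`, so `χ₁ = φ`.
-/

noncomputable section

namespace QSource

open scoped BigOperators ENNReal ComplexOrder InnerProductSpace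
open MeasureTheory Filter Topology

/-! ## Sequences vanishing on average -/

section NullSequences

/-- The sequences `u` whose absolute means over the index sets `s n` tend to zero.  This treats
both notions of mixing at once: `s n = {n}` gives the sequences tending to zero and
`s n = {1, …, n}` those which do so in the strong Cesàro sense. -/
def nullSequences (s : ℕ → Finset ℕ) : Submodule ℂ (ℕ → ℂ) where
  carrier := {u | Tendsto (fun n => 𝔼 i ∈ s n, ‖u i‖) atTop (𝓝 0)}
  zero_mem' := by simp
  add_mem' {u v} hu hv := by
    refine squeeze_zero (fun n => Finset.expect_nonneg fun i _ => norm_nonneg _) (fun n => ?_)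
      (by simpa using hu.add hv)
    rw [← Finset.expect_add_distrib]
    exact Finset.expect_le_expect fun i _ => norm_add_le _ _
  smul_mem' c u hu := by
    simpa [← Finset.mul_expect] using hu.const_mul ‖c‖

variable {s : ℕ → Finset ℕ} {u : ℕ → ℂ}

lemma mem_nullSequences :
    u ∈ nullSequences s ↔ Tendsto (fun n => 𝔼 i ∈ s n, ‖u i‖) atTop (𝓝 0) := Iff.rfl

lemma mem_nullSequences_singleton :
    u ∈ nullSequences (fun n => {n}) ↔ Tendsto u atTop (𝓝 0) := by
  simp only [mem_nullSequences, Finset.expect_singleton,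
    tendsto_zero_iff_norm_tendsto_zero (f := u)]

lemma mem_nullSequences_Icc : u ∈ nullSequences (Finset.Icc 1) ↔
    Tendsto (fun n : ℕ => (n : ℝ)⁻¹ * ∑ i ∈ Finset.Icc 1 n, ‖u i‖) atTop (𝓝 0) := by
  simp only [mem_nullSequences, Finset.expect_eq_sum_div_card, Nat.card_Icc, add_tsub_cancel_right,
    div_eq_inv_mul]

lemma mem_nullSequences_of_eq_zero (hs : ∀ i, Pi.single i 1 ∈ nullSequences s) {N : ℕ}
    (hu : ∀ i, N ≤ i → u i = 0) : u ∈ nullSequences s := by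
  have h : u = ∑ i ∈ Finset.range N, u i • Pi.single i 1 := by
    ext i
    simp only [Finset.sum_apply, Pi.smul_apply, Pi.single_apply, smul_eq_mul, mul_ite, mul_one,
      mul_zero, Finset.sum_ite_eq, Finset.mem_range]
    split_ifs with hi
    exacts [rfl, hu i (not_lt.1 hi)]
  rw [h]
  exact Submodule.sum_mem _ fun i _ => Submodule.smul_mem _ _ (hs i)

lemma single_mem_nullSequences_singleton (i : ℕ) :
    Pi.single i 1 ∈ nullSequences (fun n => {n}) := by
  rw [mem_nullSequences_singleton]
  refine tendsto_const_nhds.congr' ?_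
  filter_upwards [eventually_gt_atTop i] with n hn
  rw [Pi.single_eq_of_ne hn.ne']

lemma single_mem_nullSequences_Icc (i : ℕ) : Pi.single i 1 ∈ nullSequences (Finset.Icc 1) := by
  rw [mem_nullSequences_Icc]
  refine squeeze_zero (fun n => by positivity) (fun n => ?_) tendsto_inv_atTop_nhds_zero_nat
  refine mul_le_of_le_one_right (by positivity) ?_
  simp only [Pi.single_apply, apply_ite norm, norm_one, norm_zero, Finset.sum_ite_eq']
  split_ifs <;> norm_num

lemma mem_nullSequences_of_forall_approx
    (h : ∀ ε > 0, ∃ v ∈ nullSequences s, ∀ i, ‖u i - v i‖ ≤ ε) : u ∈ nullSequences s := by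
  refine Metric.tendsto_atTop.2 fun ε hε => ?_
  obtain ⟨v, hv, huv⟩ := h (ε / 2) (half_pos hε)
  obtain ⟨N, hN⟩ := Metric.tendsto_atTop.1 hv (ε / 2) (half_pos hε)
  refine ⟨N, fun n hn => ?_⟩
  have hle : 𝔼 i ∈ s n, ‖u i‖ ≤ ε / 2 + 𝔼 i ∈ s n, ‖v i‖ := by
    have hconst : 𝔼 _i ∈ s n, ε / 2 ≤ ε / 2 := by
      obtain h | h := (s n).eq_empty_or_nonempty
      · simpa [h] using (half_pos hε).le
      · exact (Finset.expect_const h _).le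
    refine le_trans ?_ (add_le_add_left hconst _)
    rw [← Finset.expect_add_distrib]
    exact Finset.expect_le_expect fun i _ =>
      (norm_le_norm_sub_add _ _).trans (add_le_add_left (huv i) _)
  have hlt := hN n hn
  rw [Real.dist_0_eq_abs, abs_of_nonneg (Finset.expect_nonneg fun _ _ => norm_nonneg _)] at hlt ⊢
  linarith

lemma isClosed_setOf_mem_nullSequences {E : Type*} [SeminormedAddCommGroup E] [Module ℂ E]
    (L : E →ₗ[ℂ] ℕ → ℂ) (C : ℝ) (hL : ∀ x i, ‖L x i‖ ≤ C * ‖x‖) (s : ℕ → Finset ℕ) :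
    IsClosed {x | L x ∈ nullSequences s} := by
  refine isClosed_of_closure_subset fun x hx => mem_nullSequences_of_forall_approx fun ε hε => ?_
  have hC : 0 < |C| + 1 := by positivity
  obtain ⟨y, hy, hxy⟩ := Metric.mem_closure_iff.1 hx (ε / (|C| + 1)) (by positivity)
  refine ⟨L y, hy, fun i => ?_⟩
  rw [dist_eq_norm, lt_div_iff₀ hC] at hxy
  calc ‖L x i - L y i‖ = ‖L (x - y) i‖ := by rw [map_sub, Pi.sub_apply]
    _ ≤ C * ‖x - y‖ := hL _ i
    _ ≤ ‖x - y‖ * (|C| + 1) := by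
      rw [mul_comm]
      gcongr
      linarith [le_abs_self C]
    _ ≤ ε := hxy.le

end NullSequences

section BandSum

variable {E : Type*} [SeminormedAddCommGroup E] {D : ℕ → ℕ → E} {M : ℝ} {R : ℕ}

lemma norm_sum_range_le_of_band (hM : ∀ i j, ‖D i j‖ ≤ M)
    (hD : ∀ i j, i + R < j ∨ j + R < i → D i j = 0) (n i : ℕ) :
    ‖∑ j ∈ Finset.range n, D i j‖ ≤ (2 * R + 1) * M := by
  have hM0 : 0 ≤ M := (norm_nonneg _).trans (hM 0 0)
  calc ‖∑ j ∈ Finset.range n, D i j‖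
      = ‖∑ j ∈ (Finset.range n).filter (· ∈ Finset.Icc (i - R) (i + R)), D i j‖ := by
        rw [Finset.sum_filter_of_ne fun j _ hj => ?_]
        contrapose! hj
        exact hD i j (by simp only [Finset.mem_Icc] at hj; omega)
    _ ≤ ((Finset.range n).filter (· ∈ Finset.Icc (i - R) (i + R))).card • M :=
        (norm_sum_le _ _).trans (Finset.sum_le_card_nsmul _ _ _ fun j _ => hM i j)
    _ ≤ (2 * R + 1) * M := by
        rw [nsmul_eq_mul]
        gcongr
        have hcard : ((Finset.range n).filter (· ∈ Finset.Icc (i - R) (i + R))).card ≤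
            (Finset.Icc (i - R) (i + R)).card :=
          Finset.card_le_card fun j hj => (Finset.mem_filter.1 hj).2
        rw [Nat.card_Icc] at hcard
        exact_mod_cast hcard.trans (by omega)

lemma norm_sum_range_sum_range_le_of_band (hM : ∀ i j, ‖D i j‖ ≤ M)
    (hD : ∀ i j, i + R < j ∨ j + R < i → D i j = 0) (n : ℕ) :
    ‖∑ i ∈ Finset.range n, ∑ j ∈ Finset.range n, D i j‖ ≤ n * ((2 * R + 1) * M) := by
  simpa using norm_sum_le_of_le (Finset.range n) fun i _ => norm_sum_range_le_of_band hM hD n i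

end BandSum

/-! ## Measure-preserving maps -/

section Ergodic

variable {Ω : Type*} [MeasurableSpace Ω] {μ : Measure Ω} {T : Ω → Ω} {𝕜 : Type*} [RCLike 𝕜]

lemma tendsto_birkhoffAverage_compMeasurePreserving [IsProbabilityMeasure μ] (hT : Ergodic T μ)
    (f : Lp 𝕜 2 μ) :
    Tendsto (birkhoffAverage 𝕜 (Lp.compMeasurePreserving T hT.toMeasurePreserving) id · f) atTop
      (𝓝 (Lp.const 2 μ (∫ ω, f ω ∂μ))) := by
  let U := Lp.compMeasurePreservingₗᵢ 𝕜 T hT.toMeasurePreserving (p := 2) (E := 𝕜)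
  let V : Lp 𝕜 2 μ →L[𝕜] Lp 𝕜 2 μ := U.toContinuousLinearMap
  have hlim := V.tendsto_birkhoffAverage_orthogonalProjection U.norm_toContinuousLinearMap_le f
  set F := V.eqLocus (1 : Lp 𝕜 2 μ →L[𝕜] Lp 𝕜 2 μ)
  set y := F.orthogonalProjectionOnto f with hy
  obtain ⟨c, hc⟩ : ∃ c : 𝕜, (y : Lp 𝕜 2 μ) = Lp.const 2 μ c := by
    have hyfix : Lp.compMeasurePreserving T hT.toMeasurePreserving (y : Lp 𝕜 2 μ) = y := y.2
    obtain ⟨c, hc⟩ := hT.ae_eq_const_of_ae_eq_comp_ae (Lp.aestronglyMeasurable (y : Lp 𝕜 2 μ))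
      ((Lp.coeFn_compMeasurePreserving _ hT.toMeasurePreserving).symm.trans (by rw [hyfix]))
    exact ⟨c, Lp.ext (hc.trans (Lp.coeFn_const 2 μ c).symm)⟩
  have hcf : c = ∫ ω, f ω ∂μ := by
    have h := Submodule.inner_orthogonalProjectionOnto_eq_of_mem_left (K := F)
      ⟨Lp.const 2 μ (1 : 𝕜), rfl⟩ f
    rw [Submodule.coe_inner, ← hy, hc] at h
    simpa [L2.inner_def] using h
  rwa [hc, hcf] at hlim

lemma coeFn_birkhoffAverage_compMeasurePreserving (hT : MeasurePreserving T μ μ) (f : Lp 𝕜 2 μ)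
    (n : ℕ) : (birkhoffAverage 𝕜 (Lp.compMeasurePreserving T hT) id n f : Lp 𝕜 2 μ) =ᵐ[μ]
      birkhoffAverage 𝕜 T f n := by
  have hsum : (birkhoffSum (Lp.compMeasurePreserving T hT) id n f : Lp 𝕜 2 μ) =ᵐ[μ]
      birkhoffSum T f n := by
    induction n with
    | zero =>
      rw [birkhoffSum_zero, birkhoffSum_zero']
      exact Lp.coeFn_zero 𝕜 2 μ
    | succ n ih =>
      rw [birkhoffSum_succ, id, Lp.compMeasurePreserving_iterate]
      filter_upwards [ih, Lp.coeFn_add (birkhoffSum (Lp.compMeasurePreserving T hT) id n f)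
        (Lp.compMeasurePreserving T^[n] (hT.iterate n) f),
        Lp.coeFn_compMeasurePreserving f (hT.iterate n)] with ω hsum hadd hcomp
      rw [hadd, Pi.add_apply, hsum, hcomp, birkhoffSum_succ, Function.comp_apply]
  exact (Lp.coeFn_smul _ _).trans (hsum.const_smul _)

lemma tendsto_integral_star_birkhoffAverage_mul [IsProbabilityMeasure μ] (hT : Ergodic T μ)
    {f : Ω → 𝕜} (hf : MemLp f 2 μ) :
    Tendsto (fun n => ∫ ω, star (birkhoffAverage 𝕜 T f n ω) * birkhoffAverage 𝕜 T f n ω ∂μ) atTop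
      (𝓝 (star (∫ ω, f ω ∂μ) * ∫ ω, f ω ∂μ)) := by
  have hlim := tendsto_birkhoffAverage_compMeasurePreserving hT (hf.toLp f)
  have hinner := hlim.inner (𝕜 := 𝕜) hlim
  rw [integral_congr_ae hf.coeFn_toLp] at hinner
  have hconst (c : 𝕜) : inner 𝕜 (Lp.const 2 μ c) (Lp.const 2 μ c) = star c * c := by
    rw [L2.inner_def]
    simp [RCLike.conj_mul]
  rw [hconst] at hinner
  refine hinner.congr fun n => ?_
  rw [L2.inner_def]
  refine integral_congr_ae ?_
  filter_upwards [coeFn_birkhoffAverage_compMeasurePreserving hT.toMeasurePreserving (hf.toLp f) n,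
    hT.quasiMeasurePreserving.birkhoffAverage_ae_eq_of_ae_eq 𝕜 hf.coeFn_toLp n] with ω h₁ h₂
  rw [h₁, h₂, RCLike.inner_apply, mul_comm, starRingEnd_apply]

end Ergodic

section FiniteValued

variable {Ω S S' : Type*} [MeasurableSpace Ω] {μ : Measure Ω} [IsFiniteMeasure μ]
  [MeasurableSpace S] [DiscreteMeasurableSpace S] [MeasurableSpace S'] [DiscreteMeasurableSpace S']

lemma integral_comp_eq_sum [Fintype S] {E : Type*} [NormedAddCommGroup E] [NormedSpace ℝ E]
    [CompleteSpace E] {f : Ω → S} (hf : Measurable f) (F : S → E) :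
    ∫ ω, F (f ω) ∂μ = ∑ x, μ.real (f ⁻¹' {x}) • F x := by
  rw [← integral_map hf.aemeasurable .of_discrete, integral_fintype .of_finite]
  simp only [map_measureReal_apply hf (measurableSet_singleton _)]

lemma integral_comp_mul_comp_sub_eq_sum [Fintype S] [Fintype S'] {𝕜 : Type*} [RCLike 𝕜]
    {f : Ω → S} {g : Ω → S'} (hf : Measurable f) (hg : Measurable g) (F : S → 𝕜) (G : S' → 𝕜) :
    ∫ ω, F (f ω) * G (g ω) ∂μ - (∫ ω, F (f ω) ∂μ) * ∫ ω, G (g ω) ∂μ =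
      ∑ x, ∑ y, (F x * G y) *
        (μ.real (f ⁻¹' {x} ∩ g ⁻¹' {y}) - μ.real (f ⁻¹' {x}) * μ.real (g ⁻¹' {y}) : ℝ) := by
  have hprod := integral_comp_eq_sum (μ := μ) (hf.prodMk hg) fun p : S × S' => F p.1 * G p.2
  simp only [integral_comp_eq_sum hf, integral_comp_eq_sum hg, hprod, Fintype.sum_prod_type,
    Finset.sum_mul_sum, ← Finset.sum_sub_distrib, ← Set.singleton_prod_singleton,
    Set.mk_preimage_prod, RCLike.real_smul_eq_coe_mul]
  refine Finset.sum_congr rfl fun x _ => Finset.sum_congr rfl fun y _ => ?_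
  push_cast
  ring

lemma covariance_comp_iterate_mem_nullSequences [Finite S] [Finite S'] {s : ℕ → Finset ℕ}
    {T : Ω → Ω} (hT : MeasurePreserving T μ μ)
    (hmix : ∀ A B : Set Ω, MeasurableSet A → MeasurableSet B →
      (fun i => ((μ.real (A ∩ T^[i] ⁻¹' B) - μ.real A * μ.real B : ℝ) : ℂ)) ∈ nullSequences s)
    {f : Ω → S} {g : Ω → S'} (hf : Measurable f) (hg : Measurable g) (F : S → ℂ) (G : S' → ℂ) :
    (fun i => ∫ ω, F (f ω) * G (g (T^[i] ω)) ∂μ -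
      (∫ ω, F (f ω) ∂μ) * ∫ ω, G (g (T^[i] ω)) ∂μ) ∈ nullSequences s := by
  have _ := Fintype.ofFinite S
  have _ := Fintype.ofFinite S'
  have h : (fun i => ∫ ω, F (f ω) * G (g (T^[i] ω)) ∂μ -
      (∫ ω, F (f ω) ∂μ) * ∫ ω, G (g (T^[i] ω)) ∂μ) = ∑ x, ∑ y, (F x * G y) • fun i =>
        ((μ.real (f ⁻¹' {x} ∩ T^[i] ⁻¹' (g ⁻¹' {y})) -
          μ.real (f ⁻¹' {x}) * μ.real (g ⁻¹' {y}) : ℝ) : ℂ) := by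
    ext i
    have hi := hT.iterate i
    have hreal (y : S') : μ.real (T^[i] ⁻¹' (g ⁻¹' {y})) = μ.real (g ⁻¹' {y}) :=
      hi.measureReal_preimage (hg (measurableSet_singleton y)).nullMeasurableSet
    refine (integral_comp_mul_comp_sub_eq_sum hf (hg.comp hi.measurable) F G).trans ?_
    simp only [Set.preimage_comp, hreal, Finset.sum_apply, Pi.smul_apply, smul_eq_mul]
    rfl
  rw [h]
  exact Submodule.sum_mem _ fun x _ => Submodule.sum_mem _ fun y _ => Submodule.smul_mem _ _ <|
    hmix _ _ (hf (measurableSet_singleton x)) (hg (measurableSet_singleton y))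

end FiniteValued

/-! ## States and correlations -/

section PositiveFunctional

variable {A F : Type*} [FunLike F A ℂ] {φ : F}

section StarAlgebra

variable [Ring A] [StarRing A] [Algebra ℂ A] [StarModule ℂ A] [LinearMapClass F ℂ A ℂ]

lemma map_star_of_nonneg (hφ : ∀ a, 0 ≤ φ (star a * a)) (a : A) : φ (star a) = star (φ a) := by
  have hreal (b : A) (hb : IsSelfAdjoint b) : star (φ b) = φ b := by
    have hsq : (4 : ℂ) * φ b = φ (star (b + 1) * (b + 1)) - φ (star (b - 1) * (b - 1)) := by
      rw [← smul_eq_mul, ← map_smul, ← map_sub]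
      congr 1
      simp only [star_add, star_sub, star_one, hb.star_eq, Algebra.smul_def, map_ofNat]
      noncomm_ring
    have hself := (IsSelfAdjoint.of_nonneg (hφ (b + 1))).sub (.of_nonneg (hφ (b - 1)))
    rw [← hsq, isSelfAdjoint_iff, star_mul', star_ofNat] at hself
    exact mul_left_cancel₀ four_ne_zero hself
  rw [← realPart_add_I_smul_imaginaryPart a]
  simp only [star_add, star_smul, map_add, map_smul, hreal _ (realPart a).2,
    hreal _ (imaginaryPart a).2, (realPart a).2.star_eq, (imaginaryPart a).2.star_eq]

lemma apply_star_mul_self_sub_smul_one (hφ : ∀ a, 0 ≤ φ (star a * a)) (h1 : φ 1 = 1) (a : A) :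
    φ (star (a - φ a • 1) * (a - φ a • 1)) = φ (star a * a) - star (φ a) * φ a := by
  simp only [star_sub, star_smul, star_one, sub_mul, mul_sub, smul_mul_assoc, one_mul,
    mul_smul_comm, mul_one, map_sub, map_smul, h1, map_star_of_nonneg hφ, smul_eq_mul]
  ring

lemma norm_apply_sq_le_of_nonneg (hφ : ∀ a, 0 ≤ φ (star a * a)) (h1 : φ 1 = 1) (a : A) :
    ‖φ a‖ ^ 2 ≤ (φ (star a * a)).re := by
  have h := (Complex.le_def.1 (hφ (a - φ a • 1))).1
  rwa [apply_star_mul_self_sub_smul_one hφ h1, Complex.star_def, Complex.conj_mul',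
    Complex.sub_re, ← Complex.ofReal_pow, Complex.ofReal_re, Complex.zero_re, sub_nonneg] at h

end StarAlgebra

lemma norm_apply_le_of_nonneg [CStarAlgebra A] [LinearMapClass F ℂ A ℂ]
    (hφ : ∀ a, 0 ≤ φ (star a * a)) (h1 : φ 1 = 1) (a : A) : ‖φ a‖ ≤ ‖a‖ := by
  let _ := CStarAlgebra.spectralOrder A
  have _ := CStarAlgebra.spectralOrderedRing A
  obtain ⟨c, hc⟩ := CStarAlgebra.nonneg_iff_eq_star_mul_self.1
    (sub_nonneg.2 (CStarAlgebra.star_mul_le_algebraMap_norm_sq (a := a)))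
  have hone : φ (algebraMap ℝ A (‖a‖ ^ 2)) = (‖a‖ ^ 2 : ℝ) := by
    rw [Algebra.algebraMap_eq_smul_one, ← Complex.coe_smul, map_smul, h1, smul_eq_mul, mul_one]
  have hle := (Complex.le_def.1 (hφ c)).1
  rw [← hc, map_sub, hone, Complex.sub_re, Complex.ofReal_re, Complex.zero_re, sub_nonneg] at hle
  exact (pow_le_pow_iff_left₀ (norm_nonneg _) (norm_nonneg _) two_ne_zero).1
    ((norm_apply_sq_le_of_nonneg hφ h1 a).trans hle)

end PositiveFunctional

section Quasilocal

variable {d : ℕ} {φ : quasilocal d →L[ℂ] ℂ}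

/-- The quasilocal algebra is closed, hence a C⋆-algebra.  This is not an instance, so that its ring
operations keep coming from the subalgebra structure. -/
abbrev quasilocalCStarAlgebra (d : ℕ) : CStarAlgebra (quasilocal d) :=
  StarSubalgebra.cstarAlgebra _ (h_closed := (localAlgebra d).isClosed_topologicalClosure)

lemma norm_shift_le (a : quasilocal d) : ‖shift d a‖ ≤ ‖a‖ :=
  let _ := quasilocalCStarAlgebra d
  NonUnitalStarAlgHom.norm_apply_le (shift d) a

lemma norm_shift_iterate_le (n : ℕ) (a : quasilocal d) : ‖(shift d)^[n] a‖ ≤ ‖a‖ := by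
  induction n with
  | zero => rfl
  | succ n ih =>
    rw [Function.iterate_succ_apply']
    exact (norm_shift_le _).trans ih

lemma continuous_shift : Continuous (shift d) :=
  AddMonoidHomClass.continuous_of_bound (shift d) 1 fun a => by simpa using norm_shift_le a

lemma star_shift_iterate (n : ℕ) (a : quasilocal d) :
    star ((shift d)^[n] a) = (shift d)^[n] (star a) :=
  Function.Semiconj.iterate_right (f := star) (fun b => (map_star (shift d) b).symm) n a

lemma localObs_one (Λ : Finset ℤ) : localObs Λ (1 : LocalMatrix d Λ) = 1 :=
  Subtype.ext (localOp_one Λ)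

lemma localObs_mul {Λ : Finset ℤ} (a b : LocalMatrix d Λ) :
    localObs Λ (a * b) = localObs Λ a * localObs Λ b :=
  Subtype.ext (localOp_mul Λ a b)

lemma localObs_add {Λ : Finset ℤ} (a b : LocalMatrix d Λ) :
    localObs Λ (a + b) = localObs Λ a + localObs Λ b :=
  Subtype.ext (localOp_add Λ a b)

lemma localObs_smul {Λ : Finset ℤ} (c : ℂ) (a : LocalMatrix d Λ) :
    localObs Λ (c • a) = c • localObs Λ a :=
  Subtype.ext (localOp_smul Λ c a)

lemma localObs_star {Λ : Finset ℤ} (a : LocalMatrix d Λ) :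
    localObs Λ (star a) = star (localObs Λ a) :=
  Subtype.ext (localOp_star Λ a)

lemma localObs_induction {P : quasilocal d → Prop} (isClosed : IsClosed {a | P a})
    (localObs : ∀ Λ a, P (localObs Λ a)) (a : quasilocal d) : P a := by
  have hdense : DenseRange fun p : (Σ Λ, LocalMatrix d Λ) => QSource.localObs p.1 p.2 := by
    refine Subtype.dense_iff.2 fun T hT => closure_mono ?_ hT
    rintro _ ⟨Λ, b, rfl⟩
    exact ⟨_, ⟨⟨Λ, b⟩, rfl⟩, rfl⟩
  exact hdense.induction_on a isClosed fun p => localObs p.1 p.2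

lemma IsState.norm_apply_le (hφ : IsState φ) (a : quasilocal d) : ‖φ a‖ ≤ ‖a‖ :=
  let _ := quasilocalCStarAlgebra d
  norm_apply_le_of_nonneg hφ.nonneg hφ.map_one a

/-- The covariance `φ(ab) - φ(a)φ(b)`, as a bilinear form. -/
def correlation (φ : quasilocal d →L[ℂ] ℂ) : quasilocal d →ₗ[ℂ] quasilocal d →ₗ[ℂ] ℂ :=
  (LinearMap.mul ℂ _).compr₂ φ - (LinearMap.mul ℂ ℂ).compl₁₂ φ φ

lemma correlation_apply (a b : quasilocal d) :
    correlation φ a b = φ (a * b) - φ a * φ b := rfl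

lemma IsState.norm_correlation_le (hφ : IsState φ) (a b : quasilocal d) :
    ‖correlation φ a b‖ ≤ 2 * ‖a‖ * ‖b‖ := by
  calc ‖correlation φ a b‖ ≤ ‖φ (a * b)‖ + ‖φ a * φ b‖ := norm_sub_le _ _
    _ ≤ ‖a‖ * ‖b‖ + ‖a‖ * ‖b‖ := by
      rw [norm_mul]
      gcongr
      exacts [(hφ.norm_apply_le _).trans (norm_mul_le a b), hφ.norm_apply_le a,
        hφ.norm_apply_le b]
    _ = 2 * ‖a‖ * ‖b‖ := by ring

lemma IsStationaryState.apply_shift_iterate (hφ : IsStationaryState φ) (i : ℕ)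
    (a : quasilocal d) : φ ((shift d)^[i] a) = φ a := by
  induction i generalizing a with
  | zero => rfl
  | succ i ih => rw [Function.iterate_succ_apply, ih, hφ.map_shift]

lemma IsStationaryState.apply_birkhoffAverage (hφ : IsStationaryState φ) {n : ℕ} (hn : n ≠ 0)
    (a : quasilocal d) : φ (birkhoffAverage ℂ (shift d) id n a) = φ a := by
  have hn' : (n : ℂ) ≠ 0 := Nat.cast_ne_zero.2 hn
  simp [birkhoffAverage, birkhoffSum, hφ.apply_shift_iterate, hn']

/-- Every stationary state in a convex decomposition of `φ` has at most `t⁻¹` times the variance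
of `φ`; applied to the averages, whose expectations do not depend on the number of terms, this
forces the component to agree with `φ`. -/
lemma IsStationaryState.isErgodicState (hφ : IsStationaryState φ)
    (hlim : ∀ Λ (b : LocalMatrix d Λ), Tendsto (fun n : ℕ =>
      correlation φ (star (birkhoffAverage ℂ (shift d) id n (localObs Λ b)))
        (birkhoffAverage ℂ (shift d) id n (localObs Λ b))) atTop (𝓝 0)) :
    IsErgodicState φ := by
  refine mem_extremePoints_iff_left.2 ⟨hφ, ?_⟩
  rintro χ₁ (h₁ : IsStationaryState χ₁) χ₂ (h₂ : IsStationaryState χ₂) ⟨t, s, ht, hs, -, hts⟩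
  have hvar (a : quasilocal d) : ‖χ₁ a - φ a‖ ^ 2 ≤ t⁻¹ * (correlation φ (star a) a).re := by
    set x := a - φ a • (1 : quasilocal d) with hx
    have hdecomp : (φ (star x * x)).re = t * (χ₁ (star x * x)).re + s * (χ₂ (star x * x)).re := by
      simp [← hts]
    have hnonneg : 0 ≤ (χ₂ (star x * x)).re := (Complex.le_def.1 (h₂.nonneg x)).1
    calc ‖χ₁ a - φ a‖ ^ 2 = ‖χ₁ x‖ ^ 2 := by simp [hx, h₁.map_one]
      _ ≤ (χ₁ (star x * x)).re := norm_apply_sq_le_of_nonneg h₁.nonneg h₁.map_one x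
      _ ≤ t⁻¹ * (φ (star x * x)).re := by
        rw [hdecomp, le_inv_mul_iff₀ ht]
        exact le_add_of_nonneg_right (mul_nonneg hs.le hnonneg)
      _ = t⁻¹ * (correlation φ (star a) a).re := by
        rw [apply_star_mul_self_sub_smul_one hφ.nonneg hφ.map_one, correlation_apply,
          map_star_of_nonneg hφ.nonneg]
  refine ContinuousLinearMap.ext (localObs_induction
    (isClosed_eq χ₁.continuous φ.continuous) fun Λ b => ?_)
  have hlim' := (((Complex.continuous_re.tendsto _).comp (hlim Λ b)).const_mul t⁻¹)
  rw [Complex.zero_re, mul_zero] at hlim'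
  have hzero : ‖χ₁ (localObs Λ b) - φ (localObs Λ b)‖ ^ 2 ≤ 0 :=
    ge_of_tendsto hlim' ((eventually_ne_atTop 0).mono fun n hn => by
      rw [← h₁.apply_birkhoffAverage hn, ← hφ.apply_birkhoffAverage hn]
      exact hvar _)
  exact sub_eq_zero.1 (norm_eq_zero.1 (pow_eq_zero_iff two_ne_zero |>.1
    (hzero.antisymm (sq_nonneg _))))

end Quasilocal

/-! ## Elementary tensors -/

section Tensor

variable {d : ℕ} {Λ Λ' : Finset ℤ}

lemma tensorMatrix_single_one (ζ η : Λ → Fin d) :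
    tensorMatrix (fun x => Matrix.single (ζ x) (η x) (1 : ℂ)) = Matrix.single ζ η 1 := by
  ext ζ' η'
  simp only [tensorMatrix, Matrix.of_apply, Matrix.single_apply, Fintype.prod_boole, funext_iff,
    forall_and]

lemma tensorMatrix_mul (A B : Λ → Matrix (Fin d) (Fin d) ℂ) :
    tensorMatrix A * tensorMatrix B = tensorMatrix fun x => A x * B x := by
  ext ζ η
  simp only [tensorMatrix, Matrix.mul_apply, Matrix.of_apply, ← Finset.prod_mul_distrib,
    Finset.prod_univ_sum, Fintype.piFinset_univ]

lemma trace_tensorMatrix (A : Λ → Matrix (Fin d) (Fin d) ℂ) :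
    (tensorMatrix A).trace = ∏ x, (A x).trace := by
  simp only [tensorMatrix, Matrix.trace, Matrix.diag, Matrix.of_apply, Finset.prod_univ_sum,
    Fintype.piFinset_univ]

/-- Factors are indexed by all sites, so that the same family can be read on different regions. -/
lemma tensorMatrix_induction {P : LocalMatrix d Λ → Prop}
    (add : ∀ a b, P a → P b → P (a + b)) (smul : ∀ (c : ℂ) a, P a → P (c • a))
    (tensor : ∀ A : ℤ → Matrix (Fin d) (Fin d) ℂ, (∀ x ∉ Λ, A x = 1) →
      P (tensorMatrix fun x : Λ => A x)) (a : LocalMatrix d Λ) : P a := by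
  have hsingle (ζ η : Λ → Fin d) : P (Matrix.single ζ η 1) := by
    rw [← tensorMatrix_single_one]
    convert tensor (fun x => if hx : x ∈ Λ then Matrix.single (ζ ⟨x, hx⟩) (η ⟨x, hx⟩) 1 else 1)
      (fun x hx => dif_neg hx) with x
    rw [dif_pos x.2]
  induction a using Matrix.induction_on' with
  | h_zero => simpa using smul 0 _ (tensor 1 fun _ _ => rfl)
  | h_add a b ha hb => exact add a b ha hb
  | h_std_basis ζ η c => simpa using smul c _ (hsingle ζ η)

/-- The local observable `⨂_{x ∈ Λ} A x`. -/
def tensorObs (Λ : Finset ℤ) (A : ℤ → Matrix (Fin d) (Fin d) ℂ) : quasilocal d :=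
  localObs Λ (tensorMatrix fun x : Λ => A x)

variable {A B : ℤ → Matrix (Fin d) (Fin d) ℂ}

lemma tensorObs_of_subset (h : Λ ⊆ Λ') (hA : ∀ x ∉ Λ, A x = 1) :
    tensorObs Λ' A = tensorObs Λ A := by
  refine Subtype.ext (ContinuousLinearMap.ext fun f => lp.ext (funext fun ω => ?_))
  simp only [tensorObs, localObs, localOp_apply, tensorMatrix, Matrix.of_apply]
  have hrestrict (ζ : Λ → Fin d) : Function.updateFinset ω Λ'
      (Λ'.restrict (Function.updateFinset ω Λ ζ)) = Function.updateFinset ω Λ ζ := by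
    funext x
    by_cases hx : x ∈ Λ'
    · simp [Function.updateFinset, hx]
    · simp [Function.updateFinset, hx, mt (@h x) hx]
  refine (Fintype.sum_of_injective (fun ζ => Λ'.restrict (Function.updateFinset ω Λ ζ))
    (fun ζ ζ' hζ => ?_) _ _ (fun η hη => ?_) fun ζ => ?_).symm
  · rw [← restrict_update Λ ω ζ, ← restrict_update Λ ω ζ', ← hrestrict ζ, ← hrestrict ζ']
    exact congrArg (fun η => Λ.restrict (Function.updateFinset ω Λ' η)) hζ
  · -- Outside `Λ` the factors are identities, which forces `η` to agree with `ω` there.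
    obtain ⟨x, hxΛ, hx⟩ : ∃ x : Λ', (x : ℤ) ∉ Λ ∧ ω x ≠ η x := by
      by_contra! hη'
      refine hη ⟨fun x => η ⟨x, h x.2⟩, funext fun x => ?_⟩
      by_cases hx : (x : ℤ) ∈ Λ
      · simp [Function.updateFinset, hx]
      · simpa [Function.updateFinset, hx] using hη' x hx
    rw [Finset.prod_eq_zero (Finset.mem_univ x), zero_mul]
    rw [hA x hxΛ]
    exact Matrix.one_apply_ne hx
  · rw [hrestrict]
    congr 1
    let F (x : ℤ) : ℂ := A x (ω x) (Function.updateFinset ω Λ ζ x)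
    have hF : ∀ x ∈ Λ', x ∉ Λ → F x = 1 := fun x _ hx => by
      simp [F, hA x hx, Function.updateFinset, hx]
    calc ∏ x : Λ, A x (ω x) (ζ x) = ∏ x : Λ, F x := by simp [F, Function.updateFinset]
      _ = ∏ x : Λ', F x := by
        rw [Finset.prod_coe_sort, Finset.prod_coe_sort, Finset.prod_subset h hF]

lemma tensorObs_mul (h : ∀ x ∉ Λ, A x = 1) (h' : ∀ x ∉ Λ', B x = 1) :
    tensorObs Λ A * tensorObs Λ' B = tensorObs (Λ ∪ Λ') fun x => A x * B x := by
  rw [← tensorObs_of_subset Finset.subset_union_left h,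
    ← tensorObs_of_subset Finset.subset_union_right h', tensorObs, tensorObs,
    ← localObs_mul, tensorMatrix_mul, tensorObs]

lemma shift_tensorObs (Λ : Finset ℤ) (A : ℤ → Matrix (Fin d) (Fin d) ℂ) :
    shift d (tensorObs Λ A) =
      tensorObs (Λ.map (addRightEmbedding 1)) fun x => A (x - 1) := by
  rw [tensorObs, shift_localObs]
  congr 1
  ext ζ η
  refine Fintype.prod_equiv ((Equiv.addRight (1 : ℤ)).subtypeEquiv fun x => by simp) _ _
    fun x => ?_
  simp

end Tensor

section Translates

variable {d : ℕ} {Λ : Finset ℤ} {a : quasilocal d}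

lemma shift_iterate_mem_range_localObs (ha : a ∈ Set.range (localObs Λ)) (n : ℕ) :
    (shift d)^[n] a ∈ Set.range (localObs (Λ.map (addRightEmbedding (n : ℤ)))) := by
  induction n with
  | zero =>
    have hmap : Λ.map (addRightEmbedding ((0 : ℕ) : ℤ)) = Λ := by ext; simp
    rwa [hmap]
  | succ n ih =>
    obtain ⟨b, hb⟩ := ih
    have hmap : Λ.map (addRightEmbedding ((n + 1 : ℕ) : ℤ)) =
        (Λ.map (addRightEmbedding (n : ℤ))).map (addRightEmbedding 1) := by
      rw [Finset.map_map]
      congr 1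
      ext x
      simp [add_assoc]
    rw [Function.iterate_succ_apply', ← hb, shift_localObs, hmap]
    exact Set.mem_range_self _

lemma exists_disjoint_map_addRightEmbedding (Λ₁ Λ₂ : Finset ℤ) :
    ∃ R : ℕ, ∀ i j : ℕ, i + R < j ∨ j + R < i →
      Disjoint (Λ₁.map (addRightEmbedding (i : ℤ))) (Λ₂.map (addRightEmbedding (j : ℤ))) := by
  refine ⟨∑ x ∈ Λ₁, x.natAbs + ∑ x ∈ Λ₂, x.natAbs, fun i j h => Finset.disjoint_left.2 ?_⟩
  intro z hz₁ hz₂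
  obtain ⟨x, hx, rfl⟩ := Finset.mem_map.1 hz₁
  obtain ⟨y, hy, hxy⟩ := Finset.mem_map.1 hz₂
  have hx' := Finset.single_le_sum (f := Int.natAbs) (fun _ _ => Nat.zero_le _) hx
  have hy' := Finset.single_le_sum (f := Int.natAbs) (fun _ _ => Nat.zero_le _) hy
  simp only [addRightEmbedding_apply] at hxy
  omega

end Translates

/-! ## Product states -/

section ProductState

variable {d : ℕ}

/-- The functional `a ↦ ⟨w, a w⟩`. -/
def vectorFunctional (w : ConfigSpace d) : quasilocal d →L[ℂ] ℂ where
  toFun a := ⟪w, (a : ConfigSpace d →L[ℂ] ConfigSpace d) w⟫_ℂ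
  map_add' a b := by simp
  map_smul' c a := by simp
  cont := by fun_prop

lemma isState_vectorFunctional {w : ConfigSpace d} (hw : vectorFunctional w 1 = 1) :
    IsState (vectorFunctional w) where
  nonneg a := by
    change 0 ≤ ⟪w, star (a : ConfigSpace d →L[ℂ] ConfigSpace d) ((a : ConfigSpace d →L[ℂ] _) w)⟫_ℂ
    rw [ContinuousLinearMap.star_eq_adjoint, ContinuousLinearMap.adjoint_inner_right,
      inner_self_eq_norm_sq_to_K, ← RCLike.ofReal_pow]
    exact Complex.zero_le_real.2 (sq_nonneg _)
  map_one := hw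

/-- `φ` is a weak-* limit along an ultrafilter finer than `l` (Banach–Alaoglu). -/
lemma exists_isState_of_eventually {α : Type*} {l : Filter α} [l.NeBot]
    {σ : α → quasilocal d →L[ℂ] ℂ} (hσ : ∀ i, IsState (σ i)) :
    ∃ φ : quasilocal d →L[ℂ] ℂ, IsState φ ∧ ∀ a c, (∀ᶠ i in l, σ i a = c) → φ a = c := by
  let U : Ultrafilter α := Ultrafilter.of l
  have hnorm (i : α) : ‖σ i‖ ≤ 1 :=
    (σ i).opNorm_le_bound zero_le_one fun a => by simpa using (hσ i).norm_apply_le a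
  obtain ⟨φ, -, hφ⟩ := (WeakDual.isCompact_closedBall (𝕜 := ℂ) (E := quasilocal d) 0 1)
    |>.ultrafilter_le_nhds (U.map fun i => StrongDual.toWeakDual (σ i))
      (le_principal_iff.2 (Filter.mem_map.2 (Eventually.of_forall fun i => by simpa using hnorm i)))
  have hlim (a : quasilocal d) : Tendsto (fun i => σ i a) U (𝓝 (φ a)) :=
    ((WeakDual.eval_continuous a).tendsto φ).comp hφ
  have heventually (a : quasilocal d) (c : ℂ) (h : ∀ᶠ i in l, σ i a = c) : φ a = c :=
    tendsto_nhds_unique_of_eventuallyEq (hlim a) tendsto_const_nhds (Ultrafilter.of_le l h)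
  exact ⟨WeakDual.toStrongDual φ, ⟨fun a => ge_of_tendsto' (hlim _) fun i => (hσ i).nonneg a,
    heventually 1 1 (.of_forall fun i => (hσ i).map_one)⟩, heventually⟩

/-- The unit vectors of `ℂ^d`. -/
abbrev UnitVector (d : ℕ) : Type := Metric.sphere (0 : EuclideanSpace ℂ (Fin d)) 1

lemma trace_ketbra (v : UnitVector d) :
    (ketbra (v : EuclideanSpace ℂ (Fin d))).trace = 1 := by
  rw [ketbra, Matrix.trace_vecMulVec]
  have h := inner_self_eq_norm_sq_to_K (𝕜 := ℂ) (v : EuclideanSpace ℂ (Fin d))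
  rwa [norm_eq_of_mem_sphere, RCLike.ofReal_one, one_pow,
    EuclideanSpace.inner_eq_star_dotProduct] at h

/-- The vector `⨂_{x ∈ Λ} v x`, with the sites outside `Λ` in the basis states of `τ`. -/
def productVector (τ : Config d) (v : ℤ → EuclideanSpace ℂ (Fin d)) (Λ : Finset ℤ) :
    ConfigSpace d :=
  open Classical in ∑ ζ : Λ → Fin d, lp.single 2 (Function.updateFinset τ Λ ζ) (∏ x : Λ, v x (ζ x))

lemma productVector_updateFinset (τ : Config d) (v : ℤ → EuclideanSpace ℂ (Fin d))
    (Λ : Finset ℤ) (η : Λ → Fin d) :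
    productVector τ v Λ (Function.updateFinset τ Λ η) = ∏ x : Λ, v x (η x) := by
  classical
  rw [productVector, lp.coeFn_sum, Finset.sum_apply, Finset.sum_eq_single η]
  · simp
  · intro ζ _ hζ
    rw [lp.single_apply, Pi.single_eq_of_ne]
    intro h
    exact hζ (by rw [← restrict_update Λ τ ζ, ← h, restrict_update])
  · simp

lemma vectorFunctional_productVector (τ : Config d) (v : ℤ → EuclideanSpace ℂ (Fin d))
    (Λ : Finset ℤ) (a : LocalMatrix d Λ) :
    vectorFunctional (productVector τ v Λ) (localObs Λ a) =
      ((tensorMatrix fun x : Λ => ketbra (v x)) * a).trace := by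
  calc ⟪productVector τ v Λ, localOp Λ a (productVector τ v Λ)⟫_ℂ
      = ∑ ζ : Λ → Fin d, star (∏ x : Λ, v x (ζ x)) * ∑ η, a ζ η * ∏ x : Λ, v x (η x) := by
        conv_lhs => enter [2]; rw [productVector]
        simp only [sum_inner, lp.inner_single_left, localOp_apply, restrict_update,
          updateFinset_update, productVector_updateFinset, RCLike.inner_apply', RCLike.star_def]
    _ = ((tensorMatrix fun x : Λ => ketbra (v x)) * a).trace := by
        simp only [Matrix.trace, Matrix.diag, Matrix.mul_apply, Finset.mul_sum, tensorMatrix,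
          Matrix.of_apply, ketbra, Matrix.vecMulVec_apply, Finset.prod_mul_distrib, star_prod]
        rw [Finset.sum_comm]
        exact Finset.sum_congr rfl fun η _ => Finset.sum_congr rfl fun ζ _ => by ring

lemma exists_productState (v : ℤ → UnitVector d) :
    ∃ σ : quasilocal d →L[ℂ] ℂ, IsState σ ∧ ∀ Λ (A : ℤ → Matrix (Fin d) (Fin d) ℂ),
      (∀ x ∉ Λ, A x = 1) → σ (tensorObs Λ A) = ∏ x ∈ Λ, (ketbra (v x : _) * A x).trace := by
  have hd : Nonempty (Fin d) := by
    by_contra h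
    have : IsEmpty (Fin d) := not_nonempty_iff.1 h
    simpa [Subsingleton.elim (v 0 : EuclideanSpace ℂ (Fin d)) 0] using norm_eq_of_mem_sphere (v 0)
  let σ (Λ : Finset ℤ) := vectorFunctional
    (productVector (fun _ => Classical.arbitrary (Fin d)) (fun x => (v x : EuclideanSpace ℂ _)) Λ)
  have hσ (Λ : Finset ℤ) (A : ℤ → Matrix (Fin d) (Fin d) ℂ) :
      σ Λ (tensorObs Λ A) = ∏ x ∈ Λ, (ketbra (v x : _) * A x).trace := by
    rw [tensorObs, vectorFunctional_productVector, tensorMatrix_mul, trace_tensorMatrix]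
    exact Finset.prod_coe_sort Λ fun x => (ketbra (v x : _) * A x).trace
  have hstate (Λ : Finset ℤ) : IsState (σ Λ) := isState_vectorFunctional <| by
    rw [← localObs_one Λ, vectorFunctional_productVector, mul_one, trace_tensorMatrix]
    exact Finset.prod_eq_one fun x _ => trace_ketbra (v x)
  obtain ⟨φ, hφ, heventually⟩ := exists_isState_of_eventually (l := atTop) hstate
  refine ⟨φ, hφ, fun Λ A hA => heventually _ _ ((eventually_ge_atTop Λ).mono fun Λ' h => ?_)⟩
  rw [← tensorObs_of_subset h hA, hσ]
  refine (Finset.prod_subset h fun x _ hx => ?_).symm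
  rw [hA x hx, mul_one, trace_ketbra]

/-- The product state `⨂_x |v_x⟩⟨v_x|`. -/
def productState (v : ℤ → UnitVector d) : quasilocal d →L[ℂ] ℂ :=
  (exists_productState v).choose

variable {Λ Λ₁ Λ₂ : Finset ℤ} {v : ℤ → UnitVector d}

lemma isState_productState (v : ℤ → UnitVector d) : IsState (productState v) :=
  (exists_productState v).choose_spec.1

lemma productState_tensorObs {A : ℤ → Matrix (Fin d) (Fin d) ℂ} (hA : ∀ x ∉ Λ, A x = 1) :
    productState v (tensorObs Λ A) = ∏ x ∈ Λ, (ketbra (v x : _) * A x).trace :=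
  (exists_productState v).choose_spec.2 Λ A hA

lemma productState_localObs (a : LocalMatrix d Λ) :
    productState v (localObs Λ a) =
      ((tensorMatrix fun x : Λ => ketbra (v x : EuclideanSpace ℂ (Fin d))) * a).trace := by
  induction a using tensorMatrix_induction with
  | add a b ha hb => rw [localObs_add, map_add, ha, hb, mul_add, Matrix.trace_add]
  | smul c a ha => rw [localObs_smul, map_smul, ha, mul_smul_comm, Matrix.trace_smul]
  | tensor A hA =>
    rw [← tensorObs, productState_tensorObs hA, tensorMatrix_mul, trace_tensorMatrix]
    exact (Finset.prod_coe_sort Λ fun x => (ketbra (v x : _) * A x).trace).symm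

lemma productState_shift (v : ℤ → UnitVector d) (a : quasilocal d) :
    productState v (shift d a) = productState (seqShift _ v) a := by
  induction a using localObs_induction with
  | isClosed =>
    have hcont : Continuous fun a => productState v (shift d a) :=
      (productState v).continuous.comp continuous_shift
    exact isClosed_eq hcont (productState (seqShift _ v)).continuous
  | localObs Λ a =>
  induction a using tensorMatrix_induction with
  | add a b ha hb => simp only [localObs_add, map_add, ha, hb]
  | smul c a ha => simp only [localObs_smul, map_smul, ha]
  | tensor A hA =>
    rw [← tensorObs, shift_tensorObs, productState_tensorObs hA, productState_tensorObs]
    · simp [seqShift]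
    · exact fun x hx => hA _ fun h => hx (Finset.mem_map.2 ⟨x - 1, h, by simp⟩)

lemma productState_mul_of_disjoint (h : Disjoint Λ₁ Λ₂) (a : LocalMatrix d Λ₁)
    (b : LocalMatrix d Λ₂) :
    productState v (localObs Λ₁ a * localObs Λ₂ b) =
      productState v (localObs Λ₁ a) * productState v (localObs Λ₂ b) := by
  induction a using tensorMatrix_induction with
  | add a a' ha ha' => simp only [localObs_add, map_add, add_mul, ha, ha']
  | smul c a ha => simp only [localObs_smul, map_smul, smul_mul_assoc, ha]
  | tensor A hA =>
  induction b using tensorMatrix_induction with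
  | add b b' hb hb' => simp only [localObs_add, map_add, mul_add, hb, hb']
  | smul c b hb => simp only [localObs_smul, map_smul, mul_smul_comm, hb]
  | tensor B hB =>
  rw [← tensorObs, ← tensorObs, tensorObs_mul hA hB, productState_tensorObs hA,
    productState_tensorObs hB, productState_tensorObs, Finset.prod_union h]
  · congr 1 <;> refine Finset.prod_congr rfl fun x hx => ?_
    · rw [hB x (Finset.disjoint_left.1 h hx), mul_one]
    · rw [hA x (Finset.disjoint_right.1 h hx), one_mul]
  · intro x hx
    rw [Finset.mem_union, not_or] at hx
    rw [hA x hx.1, hB x hx.2, one_mul]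

end ProductState

section LawOfLargeNumbers

variable {d : ℕ} {Λ₁ Λ₂ : Finset ℤ}

lemma correlation_productState_of_disjoint (h : Disjoint Λ₁ Λ₂) (v : ℤ → UnitVector d)
    {a b : quasilocal d} (ha : a ∈ Set.range (localObs Λ₁)) (hb : b ∈ Set.range (localObs Λ₂)) :
    correlation (productState v) a b = 0 := by
  obtain ⟨a, rfl⟩ := ha
  obtain ⟨b, rfl⟩ := hb
  exact sub_eq_zero.2 (productState_mul_of_disjoint h a b)

lemma exists_correlation_productState_shift_iterate_eq_zero {a b : quasilocal d}
    (ha : a ∈ Set.range (localObs Λ₁)) (hb : b ∈ Set.range (localObs Λ₂)) :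
    ∃ R : ℕ, ∀ (v : ℤ → UnitVector d) (i j : ℕ), i + R < j ∨ j + R < i →
      correlation (productState v) ((shift d)^[i] a) ((shift d)^[j] b) = 0 := by
  obtain ⟨R, hR⟩ := exists_disjoint_map_addRightEmbedding Λ₁ Λ₂
  exact ⟨R, fun v i j h => correlation_productState_of_disjoint (hR i j h) v
    (shift_iterate_mem_range_localObs ha i) (shift_iterate_mem_range_localObs hb j)⟩

lemma exists_norm_correlation_birkhoffAverage_le {a b : quasilocal d}
    (ha : a ∈ Set.range (localObs Λ₁)) (hb : b ∈ Set.range (localObs Λ₂)) :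
    ∃ C : ℝ, ∀ (v : ℤ → UnitVector d) (n : ℕ), ‖correlation (productState v)
      (birkhoffAverage ℂ (shift d) id n a) (birkhoffAverage ℂ (shift d) id n b)‖ ≤ C / n := by
  obtain ⟨R, hR⟩ := exists_correlation_productState_shift_iterate_eq_zero ha hb
  set M := 2 * ‖a‖ * ‖b‖ with hM
  refine ⟨(2 * R + 1) * M, fun v n => ?_⟩
  have hbound (i j : ℕ) :
      ‖correlation (productState v) ((shift d)^[i] a) ((shift d)^[j] b)‖ ≤ M := by
    refine ((isState_productState v).norm_correlation_le _ _).trans ?_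
    rw [hM]
    gcongr <;> exact norm_shift_iterate_le _ _
  have hsum := norm_sum_range_sum_range_le_of_band hbound (hR v) n
  have hexpand : correlation (productState v)
      (birkhoffAverage ℂ (shift d) id n a) (birkhoffAverage ℂ (shift d) id n b) =
      (n : ℂ)⁻¹ * ((n : ℂ)⁻¹ * ∑ i ∈ Finset.range n, ∑ j ∈ Finset.range n,
        correlation (productState v) ((shift d)^[i] a) ((shift d)^[j] b)) := by
    simp only [birkhoffAverage, birkhoffSum, id, map_smul, map_sum, LinearMap.smul_apply,
      LinearMap.sum_apply, smul_eq_mul]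
    rw [← Finset.mul_sum, Finset.sum_comm]
  rcases eq_or_ne n 0 with rfl | hn
  · simp
  rw [hexpand, norm_mul, norm_mul, norm_inv, Complex.norm_natCast]
  calc (n : ℝ)⁻¹ * ((n : ℝ)⁻¹ * _) ≤ (n : ℝ)⁻¹ * ((n : ℝ)⁻¹ * (n * ((2 * R + 1) * M))) := by
        gcongr
    _ = (2 * R + 1) * M / n := by field_simp

end LawOfLargeNumbers

/-! ## Mixtures of product states -/

section Mixture

variable {d : ℕ} {ι : Type*} {ψ : ι → UnitVector d}

lemma productState_comp_shift_iterate (ψ : ι → UnitVector d) (ω : ℤ → ι) (i : ℕ)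
    (a : quasilocal d) :
    productState (ψ ∘ ω) ((shift d)^[i] a) = productState (ψ ∘ (seqShift ι)^[i] ω) a := by
  induction i generalizing ω with
  | zero => rfl
  | succ i ih =>
    rw [Function.iterate_succ_apply', productState_shift, Function.iterate_succ_apply]
    exact ih (seqShift ι ω)

lemma productState_comp_birkhoffAverage (ψ : ι → UnitVector d) (ω : ℤ → ι) (n : ℕ)
    (a : quasilocal d) :
    productState (ψ ∘ ω) (birkhoffAverage ℂ (shift d) id n a) =
      birkhoffAverage ℂ (seqShift ι) (fun ω => productState (ψ ∘ ω) a) n ω := by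
  simp only [birkhoffAverage, birkhoffSum, id, map_smul, map_sum, productState_comp_shift_iterate]

variable [Finite ι] [MeasurableSpace ι] [DiscreteMeasurableSpace ι]

lemma measurable_productState_comp (ψ : ι → UnitVector d) (a : quasilocal d) :
    Measurable fun ω : ℤ → ι => productState (ψ ∘ ω) a := by
  have _ := Fintype.ofFinite ι
  induction a using localObs_induction with
  | isClosed =>
    refine isClosed_of_closure_subset fun a ha => ?_
    obtain ⟨u, hu, hlim⟩ := mem_closure_iff_seq_limit.1 ha
    exact measurable_of_tendsto_metrizable hu
      (tendsto_pi_nhds.2 fun ω => ((productState (ψ ∘ ω)).continuous.tendsto a).comp hlim)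
  | localObs Λ a =>
    simp only [productState_localObs]
    exact (Measurable.of_discrete (f := fun x : Λ → ι =>
      ((tensorMatrix fun i => ketbra (ψ (x i) : EuclideanSpace ℂ (Fin d))) * a).trace)).comp
      (Finset.measurable_restrict Λ)

variable (μ : Measure (ℤ → ι)) [IsProbabilityMeasure μ]

lemma memLp_productState_comp (ψ : ι → UnitVector d) (p : ℝ≥0∞) (a : quasilocal d) :
    MemLp (fun ω => productState (ψ ∘ ω) a) p μ :=
  .of_bound (measurable_productState_comp ψ a).aestronglyMeasurable ‖a‖
    (.of_forall fun _ => (isState_productState _).norm_apply_le a)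

lemma integrable_productState_comp (ψ : ι → UnitVector d) (a : quasilocal d) :
    Integrable (fun ω => productState (ψ ∘ ω) a) μ :=
  memLp_one_iff_integrable.1 (memLp_productState_comp μ ψ 1 a)

/-- The mixture `∫ ⨂_x |ψ_{ω x}⟩⟨ψ_{ω x}| dμ(ω)` of product states. -/
def mixture (ψ : ι → UnitVector d) : quasilocal d →L[ℂ] ℂ :=
  LinearMap.mkContinuous
    { toFun := fun a => ∫ ω, productState (ψ ∘ ω) a ∂μ
      map_add' := fun a b => by
        simp only [map_add]
        exact integral_add (integrable_productState_comp μ ψ a) (integrable_productState_comp μ ψ b)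
      map_smul' := fun c a => by
        simp only [map_smul, integral_smul, RingHom.id_apply] }
    1 fun a => by
      simpa [mul_comm] using norm_integral_le_of_norm_le_const (μ := μ)
        (.of_forall fun ω => (isState_productState (ψ ∘ ω)).norm_apply_le a)

lemma mixture_apply (a : quasilocal d) : mixture μ ψ a = ∫ ω, productState (ψ ∘ ω) a ∂μ := rfl

lemma isState_mixture (ψ : ι → UnitVector d) : IsState (mixture μ ψ) where
  nonneg a := integral_nonneg fun ω => (isState_productState (ψ ∘ ω)).nonneg a
  map_one := by simp [mixture_apply, (isState_productState _).map_one]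

variable {μ} in
lemma isStationaryState_mixture (ψ : ι → UnitVector d)
    (hT : MeasurePreserving (seqShift ι) μ μ) : IsStationaryState (mixture μ ψ) where
  toIsState := isState_mixture μ ψ
  map_shift a := by
    calc ∫ ω, productState (ψ ∘ ω) (shift d a) ∂μ
        = ∫ ω, productState (ψ ∘ seqShift ι ω) a ∂μ := by simp only [productState_shift]; rfl
      _ = ∫ ω, productState (ψ ∘ ω) a ∂(μ.map (seqShift ι)) :=
        (integral_map hT.aemeasurable
          (measurable_productState_comp ψ a).aestronglyMeasurable).symm
      _ = ∫ ω, productState (ψ ∘ ω) a ∂μ := by rw [hT.map_eq]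

lemma correlation_mixture (a b : quasilocal d) :
    correlation (mixture μ ψ) a b = ∫ ω, correlation (productState (ψ ∘ ω)) a b ∂μ +
      (∫ ω, productState (ψ ∘ ω) a * productState (ψ ∘ ω) b ∂μ -
        (∫ ω, productState (ψ ∘ ω) a ∂μ) * ∫ ω, productState (ψ ∘ ω) b ∂μ) := by
  have hmul : Integrable (fun ω => productState (ψ ∘ ω) a * productState (ψ ∘ ω) b) μ :=
    (memLp_productState_comp μ ψ 2 a).integrable_mul (memLp_productState_comp μ ψ 2 b)
  simp only [correlation_apply, integral_sub (integrable_productState_comp μ ψ (a * b)) hmul,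
    mixture_apply]
  ring

end Mixture

section ClassicallyCorrelated

variable {d : ℕ} {ι : Type*} [Fintype ι] [MeasurableSpace ι] [DiscreteMeasurableSpace ι]

lemma hasDensities_mixture (ψ : ι → UnitVector d) (μ : Measure (ℤ → ι)) [IsProbabilityMeasure μ] :
    HasDensities (mixture μ ψ) (clsSource (fun i => (ψ i : EuclideanSpace ℂ (Fin d)))
      (wordProb μ)) := by
  intro m a
  let F (x : box m → ι) : ℂ :=
    ((tensorMatrix fun i => ketbra (ψ (x i) : EuclideanSpace ℂ (Fin d))) * a).trace
  calc mixture μ ψ (localObs (box m) a)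
      = ∫ ω, F ((box m).restrict ω) ∂μ := by simp only [mixture_apply, productState_localObs]; rfl
    _ = ∑ x, μ.real ((box m).restrict ⁻¹' {x}) • F x :=
      integral_comp_eq_sum (Finset.measurable_restrict (X := fun _ => ι) (box m)) F
    _ = ∑ x, (wordProb μ m x : ℂ) * F x := Finset.sum_congr rfl fun x _ => by
      rw [Complex.real_smul, wordProb]
      congr 3
      ext ω
      simp [funext_iff]
    _ = _ := by simp only [F, clsSource, Finset.sum_mul, Matrix.trace_sum, smul_mul_assoc,
      Matrix.trace_smul, smul_eq_mul]

end ClassicallyCorrelated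

/-! ## Mixing and ergodicity of mixtures -/

section CorrelationSequence

variable {d : ℕ} {φ : quasilocal d →L[ℂ] ℂ}

/-- The correlations of `a` with the translates of `b`, as a bilinear map. -/
def correlationSequence (φ : quasilocal d →L[ℂ] ℂ) :
    quasilocal d →ₗ[ℂ] quasilocal d →ₗ[ℂ] ℕ → ℂ :=
  LinearMap.mk₂ ℂ (fun a b i => correlation φ a ((shift d)^[i] b))
    (fun a a' b => funext fun i => by simp)
    (fun c a b => funext fun i => by simp)
    (fun a b b' => funext fun i => by simp [iterate_map_add])
    (fun c a b => funext fun i => by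
      have hcomm : Function.Semiconj (c • ·) (shift d) (shift d) := fun b => (map_smul _ c b).symm
      simp [← hcomm.iterate_right i b])

lemma IsState.norm_correlationSequence_le (hφ : IsState φ) (a b : quasilocal d) (i : ℕ) :
    ‖correlationSequence φ a b i‖ ≤ 2 * ‖a‖ * ‖b‖ :=
  (hφ.norm_correlation_le a _).trans (by gcongr; exact norm_shift_iterate_le i b)

lemma IsState.correlationSequence_mem_nullSequences (hφ : IsState φ) {s : ℕ → Finset ℕ}
    (h : ∀ Λ₁ Λ₂ (a : LocalMatrix d Λ₁) (b : LocalMatrix d Λ₂),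
      correlationSequence φ (localObs Λ₁ a) (localObs Λ₂ b) ∈ nullSequences s)
    (a b : quasilocal d) : correlationSequence φ a b ∈ nullSequences s := by
  induction a using localObs_induction with
  | isClosed =>
    refine isClosed_setOf_mem_nullSequences ((correlationSequence φ).flip b) (2 * ‖b‖)
      (fun a i => ?_) s
    rw [mul_right_comm]
    exact hφ.norm_correlationSequence_le a b i
  | localObs Λ₁ a =>
  induction b using localObs_induction with
  | isClosed =>
    exact isClosed_setOf_mem_nullSequences (correlationSequence φ (localObs Λ₁ a)) _
      (hφ.norm_correlationSequence_le _) s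
  | localObs Λ₂ b => exact h Λ₁ Λ₂ a b

lemma IsStationaryState.isWeaklyMixingState (hφ : IsStationaryState φ)
    (h : ∀ a b, correlationSequence φ a b ∈ nullSequences (Finset.Icc 1)) :
    IsWeaklyMixingState φ where
  toIsStationaryState := hφ
  tendsto a b := (mem_nullSequences_Icc.1 (h a b)).congr fun n => by
    simp only [correlationSequence, LinearMap.mk₂_apply, correlation_apply,
      hφ.apply_shift_iterate]

lemma IsStationaryState.isStronglyMixingState (hφ : IsStationaryState φ)
    (h : ∀ a b, correlationSequence φ a b ∈ nullSequences fun n => {n}) :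
    IsStronglyMixingState φ where
  toIsStationaryState := hφ
  tendsto a b := tendsto_sub_nhds_zero_iff.1 <| (mem_nullSequences_singleton.1 (h a b)).congr
    fun n => by simp only [correlationSequence, LinearMap.mk₂_apply, correlation_apply,
      hφ.apply_shift_iterate]

end CorrelationSequence

section MixtureMixing

lemma tendsto_integral_correlation_birkhoffAverage {d : ℕ} {ι : Type*} [MeasurableSpace ι]
    (ψ : ι → UnitVector d) (μ : Measure (ℤ → ι)) [IsProbabilityMeasure μ] {Λ : Finset ℤ}
    (b : LocalMatrix d Λ) :
    Tendsto (fun n : ℕ => ∫ ω, correlation (productState (ψ ∘ ω))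
      (star (birkhoffAverage ℂ (shift d) id n (localObs Λ b)))
      (birkhoffAverage ℂ (shift d) id n (localObs Λ b)) ∂μ) atTop (𝓝 0) := by
  obtain ⟨C, hC⟩ := exists_norm_correlation_birkhoffAverage_le
    ⟨star b, localObs_star b⟩ (Set.mem_range_self b)
  refine squeeze_zero_norm (fun n => ?_) (tendsto_const_div_atTop_nhds_zero_nat C)
  have hstar : star (birkhoffAverage ℂ (shift d) id n (localObs Λ b)) =
      birkhoffAverage ℂ (shift d) id n (star (localObs Λ b)) := by
    simp [birkhoffAverage, birkhoffSum, star_shift_iterate]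
  rw [hstar]
  simpa using norm_integral_le_of_norm_le_const (μ := μ) (.of_forall fun ω => hC (ψ ∘ ω) n)

variable {d : ℕ} {ι : Type*} [Finite ι] [MeasurableSpace ι] [DiscreteMeasurableSpace ι]
  {μ : Measure (ℤ → ι)} [IsProbabilityMeasure μ]

lemma correlationSequence_mixture_mem_nullSequences (ψ : ι → UnitVector d) {s : ℕ → Finset ℕ}
    (hs : ∀ i, Pi.single i 1 ∈ nullSequences s) (hT : MeasurePreserving (seqShift ι) μ μ)
    (hmix : ∀ A B : Set (ℤ → ι), MeasurableSet A → MeasurableSet B → (fun i =>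
      ((μ.real (A ∩ (seqShift ι)^[i] ⁻¹' B) - μ.real A * μ.real B : ℝ) : ℂ)) ∈ nullSequences s)
    (a b : quasilocal d) : correlationSequence (mixture μ ψ) a b ∈ nullSequences s := by
  have _ := Fintype.ofFinite ι
  refine (isState_mixture μ ψ).correlationSequence_mem_nullSequences (fun Λ₁ Λ₂ a b => ?_) a b
  have htotal : correlationSequence (mixture μ ψ) (localObs Λ₁ a) (localObs Λ₂ b) =
      (fun i => ∫ ω, correlation (productState (ψ ∘ ω)) (localObs Λ₁ a)
        ((shift d)^[i] (localObs Λ₂ b)) ∂μ) +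
      fun i => ∫ ω, productState (ψ ∘ ω) (localObs Λ₁ a) *
          productState (ψ ∘ (seqShift ι)^[i] ω) (localObs Λ₂ b) ∂μ -
        (∫ ω, productState (ψ ∘ ω) (localObs Λ₁ a) ∂μ) *
          ∫ ω, productState (ψ ∘ (seqShift ι)^[i] ω) (localObs Λ₂ b) ∂μ := by
    ext i
    simp only [← productState_comp_shift_iterate]
    exact correlation_mixture μ _ _
  rw [htotal]
  refine Submodule.add_mem _ ?_ ?_
  · obtain ⟨R, hR⟩ := exists_correlation_productState_shift_iterate_eq_zero
      (Set.mem_range_self a) (Set.mem_range_self b)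
    refine mem_nullSequences_of_eq_zero hs (N := R + 1) fun i hi => ?_
    have hzero (ω : ℤ → ι) := hR (ψ ∘ ω) 0 i (.inl (by omega))
    simp only [Function.iterate_zero, id] at hzero
    simp only [hzero, integral_zero]
  · let F {Λ : Finset ℤ} (a : LocalMatrix d Λ) (x : Λ → ι) : ℂ :=
      ((tensorMatrix fun i => ketbra (ψ (x i) : EuclideanSpace ℂ (Fin d))) * a).trace
    simp only [productState_localObs]
    exact covariance_comp_iterate_mem_nullSequences hT hmix
      (Finset.measurable_restrict (X := fun _ => ι) Λ₁)
      (Finset.measurable_restrict (X := fun _ => ι) Λ₂) (F a) (F b)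

lemma correlation_mixture_star_birkhoffAverage (ψ : ι → UnitVector d)
    (hT : MeasurePreserving (seqShift ι) μ μ) {n : ℕ} (hn : n ≠ 0) (a : quasilocal d) :
    correlation (mixture μ ψ) (star (birkhoffAverage ℂ (shift d) id n a))
        (birkhoffAverage ℂ (shift d) id n a) =
      ∫ ω, correlation (productState (ψ ∘ ω)) (star (birkhoffAverage ℂ (shift d) id n a))
        (birkhoffAverage ℂ (shift d) id n a) ∂μ +
      (∫ ω, star (birkhoffAverage ℂ (seqShift ι) (fun ω => productState (ψ ∘ ω) a) n ω) *
          birkhoffAverage ℂ (seqShift ι) (fun ω => productState (ψ ∘ ω) a) n ω ∂μ -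
        star (mixture μ ψ a) * mixture μ ψ a) := by
  have hmean := (isStationaryState_mixture ψ hT).apply_birkhoffAverage hn a
  have hstar (ω : ℤ → ι) := map_star_of_nonneg (isState_productState (ψ ∘ ω)).nonneg
  rw [correlation_mixture, ← mixture_apply, ← mixture_apply,
    map_star_of_nonneg (isState_mixture μ ψ).nonneg, hmean]
  simp only [hstar, productState_comp_birkhoffAverage]

lemma isErgodicState_mixture (ψ : ι → UnitVector d) (hT : Ergodic (seqShift ι) μ) :
    IsErgodicState (mixture μ ψ) := by
  refine (isStationaryState_mixture ψ hT.toMeasurePreserving).isErgodicState fun Λ b => ?_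
  have hquantum := tendsto_integral_correlation_birkhoffAverage ψ μ b
  have hclassical := (tendsto_integral_star_birkhoffAverage_mul hT
    (memLp_productState_comp μ ψ 2 (localObs Λ b))).sub_const
      (star (mixture μ ψ (localObs Λ b)) * mixture μ ψ (localObs Λ b))
  rw [← mixture_apply, sub_self] at hclassical
  rw [← add_zero (0 : ℂ)]
  exact (hquantum.add hclassical).congr' ((eventually_ne_atTop 0).mono fun n hn =>
    (correlation_mixture_star_birkhoffAverage ψ hT.toMeasurePreserving hn _).symm)

lemma isWeaklyMixingState_mixture (ψ : ι → UnitVector d) (h : IsWeaklyMixing (seqShift ι) μ) :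
    IsWeaklyMixingState (mixture μ ψ) :=
  (isStationaryState_mixture ψ h.toMeasurePreserving).isWeaklyMixingState <|
    correlationSequence_mixture_mem_nullSequences ψ single_mem_nullSequences_Icc
      h.toMeasurePreserving fun A B hA hB => mem_nullSequences_Icc.2 <| by
        simpa only [Complex.norm_real, Real.norm_eq_abs] using h.tendsto A B hA hB

lemma isStronglyMixingState_mixture (ψ : ι → UnitVector d)
    (h : IsStronglyMixing (seqShift ι) μ) : IsStronglyMixingState (mixture μ ψ) :=
  (isStationaryState_mixture ψ h.toMeasurePreserving).isStronglyMixingState <|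
    correlationSequence_mixture_mem_nullSequences ψ single_mem_nullSequences_singleton
      h.toMeasurePreserving fun A B hA hB => mem_nullSequences_singleton.2 <|
        (Complex.continuous_ofReal.tendsto' 0 0 Complex.ofReal_zero).comp
          (tendsto_sub_nhds_zero_iff.2 (h.tendsto A B hA hB))

end MixtureMixing

end QSource

end

theorem corollary1_general {d : ℕ} {ι : Type*} [Fintype ι] [MeasurableSpace ι]
    [DiscreteMeasurableSpace ι]
    (ψ : ι → EuclideanSpace ℂ (Fin d)) (hunit : ∀ i, ‖ψ i‖ = 1)
    (μ : MeasureTheory.Measure (ℤ → ι)) [MeasureTheory.IsProbabilityMeasure μ] :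
    (MeasureTheory.MeasurePreserving (QSource.seqShift ι) μ μ →
      QSource.IsStationarySource (QSource.clsSource ψ (QSource.wordProb μ))) ∧
    (Ergodic (QSource.seqShift ι) μ →
      QSource.IsErgodicSource (QSource.clsSource ψ (QSource.wordProb μ))) ∧
    (QSource.IsWeaklyMixing (QSource.seqShift ι) μ →
      QSource.IsWeaklyMixingSource (QSource.clsSource ψ (QSource.wordProb μ))) ∧
    (QSource.IsStronglyMixing (QSource.seqShift ι) μ →
      QSource.IsStronglyMixingSource (QSource.clsSource ψ (QSource.wordProb μ))) := by
  let v (i : ι) : QSource.UnitVector d := ⟨ψ i, mem_sphere_zero_iff_norm.2 (hunit i)⟩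
  have hdens : QSource.HasDensities (QSource.mixture μ v)
      (QSource.clsSource ψ (QSource.wordProb μ)) := QSource.hasDensities_mixture v μ
  exact ⟨fun h => ⟨_, hdens, QSource.isStationaryState_mixture v h⟩,
    fun h => ⟨_, hdens, QSource.isErgodicState_mixture v h⟩,
    fun h => ⟨_, hdens, QSource.isWeaklyMixingState_mixture v h⟩,
    fun h => ⟨_, hdens, QSource.isStronglyMixingState_mixture v h⟩⟩

/-- A classically correlated quantum source over a linearly independent alphabet of unit vectors
inherits stationarity, ergodicity, weak mixing and strong mixing from its classical
distribution. -/
theorem corollary1 {d : ℕ} {ι : Type*} [Fintype ι] [MeasurableSpace ι]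
    [DiscreteMeasurableSpace ι]
    (ψ : ι → EuclideanSpace ℂ (Fin d)) (hψ : LinearIndependent ℂ ψ) (hunit : ∀ i, ‖ψ i‖ = 1)
    (μ : MeasureTheory.Measure (ℤ → ι)) [MeasureTheory.IsProbabilityMeasure μ] :
    (MeasureTheory.MeasurePreserving (QSource.seqShift ι) μ μ →
      QSource.IsStationarySource (QSource.clsSource ψ (QSource.wordProb μ))) ∧
    (Ergodic (QSource.seqShift ι) μ →
      QSource.IsErgodicSource (QSource.clsSource ψ (QSource.wordProb μ))) ∧
    (QSource.IsWeaklyMixing (QSource.seqShift ι) μ →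
      QSource.IsWeaklyMixingSource (QSource.clsSource ψ (QSource.wordProb μ))) ∧
    (QSource.IsStronglyMixing (QSource.seqShift ι) μ →
      QSource.IsStronglyMixingSource (QSource.clsSource ψ (QSource.wordProb μ))) :=
  corollary1_general ψ hunit μ
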